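/- Let $(\Gamma_t)_{t\ge 0}$ be the standard Gamma process: $\Gamma_0=0$, the increments are independent, $\Gamma_t-\Gamma_s$ has the Gamma distribution with shape $t-s$ and rate $1$ for $0\le s<t$, and the paths are nondecreasing and right-continuous. Let $X_1,X_2,\dots$ be i.i.d. exponential random variables with mean $1$ (possibly on another probability space). Let $f:[0,\infty)\to[0,\infty)$ be monotonic (nondecreasing or nonincreasing), and put $$\Gamma_t f=\int_{(0,t]} f\,d\Gamma,\qquad \lambda_t f=\int_0^t f(x)\,dx,\qquad R_t=\frac{\Gamma_t f}{\lambda_t f}\quad(t>0),$$ the first integral being the pathwise Lebesgue--Stieltjes integral, and $$w_k=f(k),\qquad S_n=\sum_{k=1}^n w_kX_k,\qquad W_n=\sum_{k=1}^n w_k,\qquad R_n^{\mathrm d}=\frac{S_n}{W_n}\quad(n\ge 1),$$ where a quotient with denominator $0$ is read as $0$. Then the following equivalences hold, with $t\to\infty$ through the reals and $n\to\infty$ through the integers: 1. $R_t\to1$ in probability if and only if $R_n^{\mathrm d}\to1$ in probability; 2. for every $0<p<\infty$, $R_t\to1$ in $L^p$ (that is, $\mathbb E|R_t-1|^p\to0$)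 if and only if $R_n^{\mathrm d}\to1$ in $L^p$; 3. $R_t\to1$ almost surely if and only if $R_n^{\mathrm d}\to1$ almost surely. -/

import Mathlib

open MeasureTheory ProbabilityTheory Filter Topology Set
open scoped NNReal ENNReal

noncomputable section

/-- A path on `[0, ∞)` that is nondecreasing and right-continuous. -/
def IsIncreasingRightContinuous (γ : ℝ≥0 → ℝ) : Prop :=
  Monotone γ ∧ ∀ t, ContinuousWithinAt γ (Ici t) t

/-- A nondecreasing right-continuous path on `[0, ∞)`, extended to `(-∞, 0)` by its value at `0`,
as a Stieltjes function on the line. -/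
def pathStieltjes (γ : ℝ≥0 → ℝ) (h : IsIncreasingRightContinuous γ) : StieltjesFunction ℝ where
  toFun x := γ x.toNNReal
  mono' := h.1.comp (fun _ _ hxy => Real.toNNReal_mono hxy)
  right_continuous' x :=
    (h.2 x.toNNReal).comp continuous_real_toNNReal.continuousWithinAt
      (fun _ hy => Real.toNNReal_mono hy)

open Classical in
/-- The Lebesgue–Stieltjes measure `dγ` of a nondecreasing right-continuous path
(the zero measure for any other path). It has no mass on `(-∞, 0]`. -/
def pathMeasure (γ : ℝ≥0 → ℝ) : Measure ℝ :=
  if h : IsIncreasingRightContinuous γ then (pathStieltjes γ h).measure else 0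

/-- The standard Gamma process on `[0, ∞)`: it starts at `0`, has independent increments,
the increment over `[s, t]` has the Gamma distribution with shape `t - s` and rate `1`
(so that the value at time `1` is exponential with mean `1`), and almost all paths are
nondecreasing and right-continuous. -/
structure IsGammaProcess {Ω : Type*} [MeasurableSpace Ω] (Γ : ℝ≥0 → Ω → ℝ) (P : Measure Ω) :
    Prop where
  zero : ∀ᵐ ω ∂P, Γ 0 ω = 0
  indep : HasIndepIncrements Γ P
  law : ∀ s t : ℝ≥0, s < t → HasLaw (fun ω => Γ t ω - Γ s ω) (gammaMeasure (t - s : ℝ) 1) P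
  path : ∀ᵐ ω ∂P, IsIncreasingRightContinuous (fun t => Γ t ω)

/-- The pathwise stochastic integral `Γ_t f = ∫_{(0,t]} f dΓ`. -/
def gammaIntegral {Ω : Type*} (Γ : ℝ≥0 → Ω → ℝ) (f : ℝ → ℝ) (t : ℝ) (ω : Ω) : ℝ :=
  ∫ x in Ioc 0 t, f x ∂(pathMeasure fun s => Γ s ω)

/-- `R_t = Γ_t f / λ_t f`, where `λ_t f = ∫₀ᵗ f(x) dx`. -/
def gammaRatio {Ω : Type*} (Γ : ℝ≥0 → Ω → ℝ) (f : ℝ → ℝ) (t : ℝ) (ω : Ω) : ℝ :=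
  gammaIntegral Γ f t ω / ∫ x in (0 : ℝ)..t, f x

/-- `X 1, X 2, …` are independent standard exponential random variables (`X 0` plays no role). -/
structure IsIIDStdExponential {Ω : Type*} [MeasurableSpace Ω] (X : ℕ → Ω → ℝ) (P : Measure Ω) :
    Prop where
  indep : iIndepFun (fun k => X (k + 1)) P
  law : ∀ k, 1 ≤ k → HasLaw (X k) (expMeasure 1) P

/-- `S_n / W_n`, where `S_n = ∑_{k=1}^n w_k X_k` and `W_n = ∑_{k=1}^n w_k`. -/
def weightedRatio {Ω : Type*} (w : ℕ → ℝ) (X : ℕ → Ω → ℝ) (n : ℕ) (ω : Ω) : ℝ :=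
  (∑ k ∈ Finset.Icc 1 n, w k * X k ω) / ∑ k ∈ Finset.Icc 1 n, w k

end

/-! The unit increments `ξ_k = Γ_k - Γ_{k-1}` are i.i.d. standard exponential. Since `f` is
monotone, `Γ_n f` lies between the right-endpoint sum `∑ f(k) ξ_k` and the left-endpoint sum `∑
f(k-1) ξ_k`. Up to a shift of the sequence and the single term `f(0) ξ_1`, both are weighted sums of
i.i.d. exponentials.

Suppose the weights are negligible: `W_n → ∞` and `f(n)/W_n → 0`. Then `λ_n f`, `λ_{n+1} f`, `W_n`
and `W_{n+1}` are asymptotically equal and `f(0) ξ_1` disappears in the limit, so the sandwich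
transfers convergence both ways (`NegligibleWeights.null_gammaRatio`,
`NegligibleWeights.null_weightedRatio`). Every mode depends only on the joint law of the exponential
sequence, so sequences can be exchanged, even between probability spaces.

If the weights are not negligible, both ratios fail to converge even in probability, hence in every
mode (`negligibleWeights_or_not_null`). Unless all weights vanish, a single summand carries a fixed
proportion of `W_n` infinitely often, which prevents concentration of the discrete ratio. For the
Gamma process, unless `f` vanishes on `(0, ∞)`, the Laplace bound `E exp(-Γ_t g) ≥ exp(-∫ log(1+g))`
is applied to `g = f / λ_t f`: where `g` is bounded below, `log(1+g)` is smaller than `g` by a fixed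
factor, so `E exp(-R_t)` stays above `exp(-1)` by a fixed amount along some times `t → ∞`. -/

/-- The three modes of convergence: in measure, in `L^p`, almost everywhere. -/
inductive ConvMode
  | inMeasure
  | inLp (p : ℝ≥0∞)
  | ae

/-! ### Stability of the three modes of convergence -/

namespace ConvMode

/-- Exponents of `L^p` convergence are restricted to `0 < p < ∞`. -/
def Admissible : ConvMode → Prop
  | inLp p => p ≠ 0 ∧ p ≠ ∞
  | _ => True

/-- `m.Null P l Y`: the family `Y` converges to `0` along `l` in the mode `m`. -/
def Null (m : ConvMode) {ι Ω : Type*} [MeasurableSpace Ω] (P : Measure Ω) (l : Filter ι)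
    (Y : ι → Ω → ℝ) : Prop :=
  match m with
  | inMeasure => TendstoInMeasure P Y l (fun _ => 0)
  | inLp p => Tendsto (fun i => eLpNorm (Y i) p P) l (𝓝 0)
  | ae => ∀ᵐ ω ∂P, Tendsto (fun i => Y i ω) l (𝓝 0)

variable {ι κ Ω Ω' : Type*} [MeasurableSpace Ω] [MeasurableSpace Ω'] {P : Measure Ω}
  {P' : Measure Ω'} {l : Filter ι} {m : ConvMode}

theorem null_inMeasure_iff {Y : ι → Ω → ℝ} :
    inMeasure.Null P l Y ↔ ∀ ε, 0 < ε → Tendsto (fun i => P {ω | ε ≤ |Y i ω|}) l (𝓝 0) := by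
  simp [Null, tendstoInMeasure_iff_norm]

/-- The exceptional null set must not depend on `i`: in the mode `ae` the index may be real time,
where a union of null sets need not be null. -/
theorem Null.mono {Y Z : ι → Ω → ℝ} (hZ : m.Null P l Z) {s : Set ι} (hs : s ∈ l)
    (h : ∀ᵐ ω ∂P, ∀ i ∈ s, |Y i ω| ≤ |Z i ω|) : m.Null P l Y := by
  cases m with
  | inMeasure =>
    rw [null_inMeasure_iff] at hZ ⊢
    intro ε hε
    refine tendsto_of_tendsto_of_tendsto_of_le_of_le' tendsto_const_nhds (hZ ε hε)
      (Eventually.of_forall fun _ => zero_le) ?_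
    filter_upwards [hs] with i hi
    refine measure_mono_ae ?_
    filter_upwards [h] with ω hω
    exact fun (h1 : ε ≤ |Y i ω|) => h1.trans (hω i hi)
  | inLp p =>
    refine tendsto_of_tendsto_of_tendsto_of_le_of_le' tendsto_const_nhds hZ
      (Eventually.of_forall fun _ => zero_le) ?_
    filter_upwards [hs] with i hi
    refine eLpNorm_mono_ae ?_
    filter_upwards [h] with ω hω using hω i hi
  | ae =>
    simp only [Null] at hZ ⊢
    filter_upwards [hZ, h] with ω h1 h2
    refine squeeze_zero_norm' ?_ (by simpa using h1.abs)
    filter_upwards [hs] with i hi using h2 i hi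

theorem Null.add {Y Z : ι → Ω → ℝ} (hY : m.Null P l Y) (hZ : m.Null P l Z)
    (mY : ∀ i, AEMeasurable (Y i) P) (mZ : ∀ i, AEMeasurable (Z i) P) :
    m.Null P l (fun i ω => Y i ω + Z i ω) := by
  cases m with
  | inMeasure =>
    rw [null_inMeasure_iff] at hY hZ ⊢
    intro ε hε
    have := (hY (ε / 2) (by positivity)).add (hZ (ε / 2) (by positivity))
    rw [add_zero] at this
    refine tendsto_of_tendsto_of_tendsto_of_le_of_le tendsto_const_nhds this
      (fun _ => zero_le) fun i => ?_
    refine (measure_mono ?_).trans (measure_union_le _ _)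
    intro ω (hω : ε ≤ |Y i ω + Z i ω|)
    by_contra hc
    simp only [mem_union, mem_ofPred_eq, not_or, not_le] at hc
    have := abs_add_le (Y i ω) (Z i ω)
    linarith
  | inLp p =>
    simp only [Null] at hY hZ ⊢
    -- For `p < 1` the triangle inequality holds only up to the finite constant `LpAddConst p`.
    have := ENNReal.Tendsto.const_mul (a := ENNReal.LpAddConst p) (hY.add hZ)
      (Or.inr (ENNReal.LpAddConst_lt_top p).ne)
    rw [add_zero, mul_zero] at this
    exact tendsto_of_tendsto_of_tendsto_of_le_of_le tendsto_const_nhds this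
      (fun _ => zero_le) fun i => eLpNorm_add_le' (mY i).aestronglyMeasurable
        (mZ i).aestronglyMeasurable p
  | ae =>
    simp only [Null] at hY hZ ⊢
    filter_upwards [hY, hZ] with ω h1 h2
    simpa using h1.add h2

theorem Null.const_mul {Y : ι → Ω → ℝ} (hY : m.Null P l Y) (c : ℝ) :
    m.Null P l (fun i ω => c * Y i ω) := by
  cases m with
  | inMeasure =>
    rw [null_inMeasure_iff] at hY ⊢
    intro ε hε
    refine tendsto_of_tendsto_of_tendsto_of_le_of_le tendsto_const_nhds
      (hY (ε / (|c| + 1)) (by positivity)) (fun _ => zero_le) fun i => measure_mono ?_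
    intro ω (hω : ε ≤ |c * Y i ω|)
    change ε / (|c| + 1) ≤ |Y i ω|
    rw [div_le_iff₀ (by positivity)]
    rw [abs_mul] at hω
    nlinarith [abs_nonneg (Y i ω)]
  | inLp p =>
    simp only [Null] at hY ⊢
    have := ENNReal.Tendsto.const_mul (a := ‖c‖ₑ) hY (Or.inr enorm_ne_top)
    rw [mul_zero] at this
    refine this.congr fun i => ?_
    exact (eLpNorm_const_smul c (Y i) p P).symm
  | ae =>
    simp only [Null] at hY ⊢
    filter_upwards [hY] with ω h1
    simpa using h1.const_mul c

theorem Null.mul_of_tendsto {Y : ι → Ω → ℝ} (hY : m.Null P l Y) {u : ι → ℝ} {c : ℝ}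
    (hu : Tendsto u l (𝓝 c)) : m.Null P l (fun i ω => u i * Y i ω) := by
  have hs : {i | |u i| ≤ |c| + 1} ∈ l := by
    filter_upwards [hu.abs.eventually_lt_const (lt_add_one |c|)] with i hi using hi.le
  refine (hY.const_mul (|c| + 1)).mono hs (ae_of_all _ fun ω i hi => ?_)
  rw [abs_mul, abs_mul]
  exact mul_le_mul_of_nonneg_right (le_trans hi (le_abs_self _)) (abs_nonneg _)

theorem null_tendsto_mul (hm : m.Admissible) [IsFiniteMeasure P] {u : ι → ℝ}
    (hu : Tendsto u l (𝓝 0)) {ξ : Ω → ℝ} (mξ : AEMeasurable ξ P)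
    (hξ : ∀ p : ℝ≥0∞, p ≠ ∞ → MemLp ξ p P) [l.IsCountablyGenerated] :
    m.Null P l (fun i ω => u i * ξ ω) := by
  have hae : ∀ ω, Tendsto (fun i => u i * ξ ω) l (𝓝 0) := fun ω => by
    simpa using hu.mul_const (ξ ω)
  cases m with
  | inMeasure =>
    have h1 := hξ 1 (by simp)
    refine tendstoInMeasure_of_tendsto_eLpNorm one_ne_zero
      (fun i => (mξ.const_mul (u i)).aestronglyMeasurable) aestronglyMeasurable_const ?_
    have := ENNReal.Tendsto.mul_const (b := eLpNorm ξ 1 P) hu.enorm (Or.inr h1.eLpNorm_ne_top)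
    rw [enorm_zero, zero_mul] at this
    refine this.congr fun i => ?_
    rw [← eLpNorm_const_smul]
    congr 1
    ext ω
    simp
  | inLp p =>
    have h1 := hξ p hm.2
    have := ENNReal.Tendsto.mul_const (b := eLpNorm ξ p P) hu.enorm (Or.inr h1.eLpNorm_ne_top)
    rw [enorm_zero, zero_mul] at this
    refine this.congr fun i => ?_
    exact (eLpNorm_const_smul (u i) ξ p P).symm
  | ae => exact ae_of_all _ hae

theorem null_const (hm : m.Admissible) [IsFiniteMeasure P] {u : ι → ℝ}
    (hu : Tendsto u l (𝓝 0)) [l.IsCountablyGenerated] : m.Null P l (fun i (_ : Ω) => u i) := by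
  simpa using null_tendsto_mul hm hu (P := P) (ξ := fun _ => 1) aemeasurable_const
    (fun p _ => memLp_const 1)

theorem Null.comp {Y : ι → Ω → ℝ} (hY : m.Null P l Y) {l' : Filter κ} {k : κ → ι}
    (hk : Tendsto k l' l) : m.Null P l' (fun j ω => Y (k j) ω) := by
  cases m with
  | inMeasure => exact TendstoInMeasure.comp hY hk
  | inLp p =>
    simp only [Null] at hY ⊢
    exact hY.comp hk
  | ae =>
    simp only [Null] at hY ⊢
    filter_upwards [hY] with ω h1 using h1.comp hk

/-- With `E` the space of sequences, almost sure convergence is also a property of the law, because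
the convergence set is measurable in `E`. -/
theorem Null.of_identDistrib {E : Type*} [MeasurableSpace E] {U : Ω → E} {V : Ω' → E}
    (h : IdentDistrib U V P P') {g : ℕ → E → ℝ} (hg : ∀ n, Measurable (g n))
    (hU : m.Null P atTop (fun n ω => g n (U ω))) : m.Null P' atTop (fun n ω => g n (V ω)) := by
  cases m with
  | inMeasure =>
    rw [null_inMeasure_iff] at hU ⊢
    intro ε hε
    refine (hU ε hε).congr fun n => ?_
    exact h.measure_mem_eq (s := {x | ε ≤ |g n x|})
      (measurableSet_le measurable_const (hg n).abs)
  | inLp p =>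
    refine Tendsto.congr (fun n => ?_) hU
    exact (h.comp (hg n)).eLpNorm_eq p
  | ae =>
    exact h.ae_snd (p := fun x => Tendsto (fun n => g n x) atTop (𝓝 0))
      (measurableSet_tendsto _ hg) hU

/-- Convergence in probability is the weakest mode, so disproving it settles the other two. -/
theorem Null.tendstoInMeasure (hm : m.Admissible) [IsFiniteMeasure P] {Y : ι → Ω → ℝ}
    (mY : ∀ i, AEMeasurable (Y i) P) [l.IsCountablyGenerated] (hY : m.Null P l Y) :
    inMeasure.Null P l Y := by
  cases m with
  | inMeasure => exact hY
  | inLp p =>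
    refine tendstoInMeasure_of_tendsto_eLpNorm hm.1
      (fun i => (mY i).aestronglyMeasurable) aestronglyMeasurable_const ?_
    refine Tendsto.congr (fun i => ?_) hY
    congr 1
    ext ω
    simp
  | ae =>
    simp only [Null] at hY ⊢
    -- The passage from a.e. convergence to convergence in measure is sequential; a countably
    -- generated filter reduces to sequences.
    refine tendstoInMeasure_of_ne_top fun ε hε hε' => tendsto_of_seq_tendsto fun x hx => ?_
    exact tendstoInMeasure_of_tendsto_ae (fun n => (mY (x n)).aestronglyMeasurable)
      (by filter_upwards [hY] with ω h1 using h1.comp hx) ε hε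

end ConvMode

/-! ### Monotone functions and Riemann sums -/

section RiemannSums

variable {f : ℝ → ℝ} {μ : Measure ℝ}

theorem integrableOn_Ioc_of_monotoneOn_or_antitoneOn [IsLocallyFiniteMeasure μ]
    (hf : MonotoneOn f (Ici 0) ∨ AntitoneOn f (Ici 0)) {a b : ℝ} (ha : 0 ≤ a) :
    IntegrableOn f (Ioc a b) μ := by
  have hsub : Icc a b ⊆ Ici 0 := fun x hx => ha.trans hx.1
  refine IntegrableOn.mono_set ?_ Ioc_subset_Icc_self
  rcases hf with hf | hf
  · exact (hf.mono hsub).integrableOn_isCompact isCompact_Icc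
  · exact (hf.mono hsub).integrableOn_isCompact isCompact_Icc

theorem setIntegral_Ioc_le [IsLocallyFiniteMeasure μ]
    (hf : MonotoneOn f (Ici 0) ∨ AntitoneOn f (Ici 0)) {a b c : ℝ} (ha : 0 ≤ a)
    (h : ∀ x ∈ Ioc a b, f x ≤ c) : ∫ x in Ioc a b, f x ∂μ ≤ c * μ.real (Ioc a b) := by
  have := setIntegral_mono_on (integrableOn_Ioc_of_monotoneOn_or_antitoneOn (μ := μ) hf ha)
    (integrableOn_const measure_Ioc_lt_top.ne) measurableSet_Ioc h
  rwa [setIntegral_const, smul_eq_mul, mul_comm] at this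

theorem le_setIntegral_Ioc [IsLocallyFiniteMeasure μ]
    (hf : MonotoneOn f (Ici 0) ∨ AntitoneOn f (Ici 0)) {a b c : ℝ} (ha : 0 ≤ a)
    (h : ∀ x ∈ Ioc a b, c ≤ f x) : c * μ.real (Ioc a b) ≤ ∫ x in Ioc a b, f x ∂μ := by
  have := setIntegral_mono_on
    (integrableOn_const (C := c) (μ := μ) (s := Ioc a b) measure_Ioc_lt_top.ne)
    (integrableOn_Ioc_of_monotoneOn_or_antitoneOn (μ := μ) hf ha) measurableSet_Ioc h
  rwa [setIntegral_const, smul_eq_mul, mul_comm] at this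

theorem setIntegral_Ioc_add [IsLocallyFiniteMeasure μ]
    (hf : MonotoneOn f (Ici 0) ∨ AntitoneOn f (Ici 0)) {a b c : ℝ} (ha : 0 ≤ a) (hab : a ≤ b)
    (hbc : b ≤ c) :
    ∫ x in Ioc a c, f x ∂μ = ∫ x in Ioc a b, f x ∂μ + ∫ x in Ioc b c, f x ∂μ := by
  rw [← Ioc_union_Ioc_eq_Ioc hab hbc]
  exact setIntegral_union (Ioc_disjoint_Ioc_of_le le_rfl) measurableSet_Ioc
    (integrableOn_Ioc_of_monotoneOn_or_antitoneOn hf ha)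
    (integrableOn_Ioc_of_monotoneOn_or_antitoneOn hf (ha.trans hab))

theorem setIntegral_Ioc_eq_sum [IsLocallyFiniteMeasure μ]
    (hf : MonotoneOn f (Ici 0) ∨ AntitoneOn f (Ici 0)) {h : ℝ} (hh : 0 ≤ h) (n : ℕ) :
    ∫ x in Ioc 0 (h * n), f x ∂μ =
      ∑ i ∈ Finset.range n, ∫ x in Ioc (h * i) (h * (i + 1)), f x ∂μ := by
  induction n with
  | zero => simp
  | succ n ih =>
    rw [Finset.sum_range_succ, ← ih]
    push_cast
    exact setIntegral_Ioc_add hf le_rfl (by positivity) (by gcongr; linarith)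

theorem MonotoneOn.sum_le_setIntegral_Ioc [IsLocallyFiniteMeasure μ]
    (hf : MonotoneOn f (Ici 0)) {h : ℝ} (hh : 0 ≤ h) (n : ℕ) :
    ∑ i ∈ Finset.range n, f (h * i) * μ.real (Ioc (h * i) (h * (i + 1))) ≤
      ∫ x in Ioc 0 (h * n), f x ∂μ := by
  rw [setIntegral_Ioc_eq_sum (.inl hf) hh]
  refine Finset.sum_le_sum fun i _ => ?_
  have h0 : 0 ≤ h * i := by positivity
  exact le_setIntegral_Ioc (.inl hf) h0 fun x hx => hf h0 (h0.trans hx.1.le) hx.1.le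

theorem MonotoneOn.setIntegral_Ioc_le_sum [IsLocallyFiniteMeasure μ]
    (hf : MonotoneOn f (Ici 0)) {h : ℝ} (hh : 0 ≤ h) (n : ℕ) :
    ∫ x in Ioc 0 (h * n), f x ∂μ ≤
      ∑ i ∈ Finset.range n, f (h * (i + 1)) * μ.real (Ioc (h * i) (h * (i + 1))) := by
  rw [setIntegral_Ioc_eq_sum (.inl hf) hh]
  refine Finset.sum_le_sum fun i _ => ?_
  have h0 : 0 ≤ h * i := by positivity
  exact setIntegral_Ioc_le (.inl hf) h0 fun x hx =>
    hf (h0.trans hx.1.le) (show 0 ≤ h * (i + 1) by positivity) hx.2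

theorem AntitoneOn.sum_le_setIntegral_Ioc [IsLocallyFiniteMeasure μ]
    (hf : AntitoneOn f (Ici 0)) {h : ℝ} (hh : 0 ≤ h) (n : ℕ) :
    ∑ i ∈ Finset.range n, f (h * (i + 1)) * μ.real (Ioc (h * i) (h * (i + 1))) ≤
      ∫ x in Ioc 0 (h * n), f x ∂μ := by
  have := hf.neg.setIntegral_Ioc_le_sum (μ := μ) hh n
  simp only [integral_neg, neg_mul, Finset.sum_neg_distrib] at this
  linarith

theorem AntitoneOn.setIntegral_Ioc_le_sum [IsLocallyFiniteMeasure μ]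
    (hf : AntitoneOn f (Ici 0)) {h : ℝ} (hh : 0 ≤ h) (n : ℕ) :
    ∫ x in Ioc 0 (h * n), f x ∂μ ≤
      ∑ i ∈ Finset.range n, f (h * i) * μ.real (Ioc (h * i) (h * (i + 1))) := by
  have := hf.neg.sum_le_setIntegral_Ioc (μ := μ) hh n
  simp only [integral_neg, neg_mul, Finset.sum_neg_distrib] at this
  linarith

end RiemannSums

/-! ### The Lebesgue–Stieltjes measure of a path -/

section PathMeasure

instance isLocallyFiniteMeasure_pathMeasure (γ : ℝ≥0 → ℝ) :
    IsLocallyFiniteMeasure (pathMeasure γ) := by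
  unfold pathMeasure
  split_ifs <;> infer_instance

theorem pathMeasure_Ioc {γ : ℝ≥0 → ℝ} (hγ : IsIncreasingRightContinuous γ) (a b : ℝ) :
    pathMeasure γ (Ioc a b) = ENNReal.ofReal (γ b.toNNReal - γ a.toNNReal) := by
  rw [pathMeasure, dif_pos hγ, StieltjesFunction.measure_Ioc]
  rfl

theorem pathMeasure_real_Ioc {γ : ℝ≥0 → ℝ} (hγ : IsIncreasingRightContinuous γ) {a b : ℝ}
    (hab : a ≤ b) :
    (pathMeasure γ).real (Ioc a b) = γ b.toNNReal - γ a.toNNReal := by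
  rw [measureReal_def, pathMeasure_Ioc hγ, ENNReal.toReal_ofReal]
  exact sub_nonneg.2 (hγ.1 (Real.toNNReal_mono hab))

theorem gammaIntegral_nonneg {Ω : Type*} {Γ : ℝ≥0 → Ω → ℝ} {f : ℝ → ℝ}
    (hf0 : ∀ x, 0 ≤ x → 0 ≤ f x) (t : ℝ) (ω : Ω) :
    0 ≤ gammaIntegral Γ f t ω :=
  setIntegral_nonneg measurableSet_Ioc fun x hx => hf0 x hx.1.le

variable {Ω : Type*} [MeasurableSpace Ω] {Γ : ℝ≥0 → Ω → ℝ} {P : Measure Ω}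

theorem IsGammaProcess.aemeasurable (hΓ : IsGammaProcess Γ P) (t : ℝ≥0) :
    AEMeasurable (Γ t) P := by
  rcases eq_or_lt_of_le (zero_le (a := t)) with rfl | ht
  · refine (aemeasurable_const (b := (0 : ℝ))).congr ?_
    filter_upwards [hΓ.zero] with ω h using h.symm
  · refine (hΓ.law 0 t ht).aemeasurable.congr ?_
    filter_upwards [hΓ.zero] with ω h
    rw [h, sub_zero]

/-- On a measurable set of full measure the paths agree with measurable versions at countably many
times. These determine the restricted path measure on rational half-lines, so it is a measurable
kernel. -/
theorem aemeasurable_gammaIntegral (hΓ : IsGammaProcess Γ P) {f : ℝ → ℝ}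
    (hf0 : ∀ x, 0 ≤ x → 0 ≤ f x) (hf : MonotoneOn f (Ici 0) ∨ AntitoneOn f (Ici 0)) (t : ℝ) :
    AEMeasurable (gammaIntegral Γ f t) P := by
  rcases lt_or_ge t 0 with ht | ht
  · refine (aemeasurable_const (b := (0 : ℝ))).congr (ae_of_all _ fun ω => ?_)
    simp [gammaIntegral, Ioc_eq_empty (not_lt.2 ht.le)]
  let G : ℝ≥0 → Ω → ℝ := fun s => (hΓ.aemeasurable s).mk
  -- `Ioc 0 t ∩ Iic q` is `Ioc 0 (min t q)`, whose mass is the increment up to `τ q`.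
  let τ : ℚ → ℝ≥0 := fun q => (min t q).toNNReal
  have hae : ∀ᵐ ω ∂P, IsIncreasingRightContinuous (fun s => Γ s ω) ∧ Γ 0 ω = G 0 ω ∧
      Γ t.toNNReal ω = G t.toNNReal ω ∧ ∀ q : ℚ, Γ (τ q) ω = G (τ q) ω := by
    filter_upwards [hΓ.path, (hΓ.aemeasurable 0).ae_eq_mk, (hΓ.aemeasurable t.toNNReal).ae_eq_mk,
      ae_all_iff.2 fun q => (hΓ.aemeasurable (τ q)).ae_eq_mk] with ω h1 h2 h3 h4
    exact ⟨h1, h2, h3, h4⟩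
  obtain ⟨A, hA, mA, hPA⟩ : ∃ A : Set Ω, (∀ ω ∈ A, IsIncreasingRightContinuous (fun s => Γ s ω) ∧
      Γ 0 ω = G 0 ω ∧ Γ t.toNNReal ω = G t.toNNReal ω ∧ ∀ q : ℚ, Γ (τ q) ω = G (τ q) ω) ∧
      MeasurableSet A ∧ ∀ᵐ ω ∂P, ω ∈ A := by
    obtain ⟨s, hs, h1, h2⟩ := hae.exists_measurable_mem
    exact ⟨s, h2, h1, hs⟩
  classical
  let κ : Ω → Measure ℝ := fun ω =>
    if ω ∈ A then (pathMeasure fun s => Γ s ω).restrict (Ioc 0 t) else 0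
  have hfin : ∀ ω, IsFiniteMeasure (κ ω) := fun ω => by
    simp only [κ]
    split_ifs
    · exact ⟨by rw [Measure.restrict_apply_univ]; exact measure_Ioc_lt_top⟩
    · infer_instance
  have hκ : Measurable κ := by
    refine Measurable.measure_of_isPiSystem Real.borel_eq_generateFrom_Iic_rat
      Real.isPiSystem_Iic_rat ?_ ?_
    · intro s hs
      simp only [mem_iUnion, mem_singleton_iff] at hs
      obtain ⟨q, rfl⟩ := hs
      have : (fun ω => κ ω (Iic (q : ℝ))) =
          A.indicator fun ω => ENNReal.ofReal (G (τ q) ω - G 0 ω) := by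
        ext ω
        by_cases hω : ω ∈ A
        · obtain ⟨h1, h2, -, h4⟩ := hA ω hω
          simp only [κ, hω, if_true, indicator_of_mem]
          rw [Measure.restrict_apply measurableSet_Iic, inter_comm, Ioc_inter_Iic,
            pathMeasure_Ioc h1, Real.toNNReal_zero, h2, ← h4 q]
        · simp [κ, hω]
      rw [this]
      exact (((hΓ.aemeasurable _).measurable_mk.sub
        (hΓ.aemeasurable _).measurable_mk).ennreal_ofReal).indicator mA
    · have : (fun ω => κ ω univ) =
          A.indicator fun ω => ENNReal.ofReal (G t.toNNReal ω - G 0 ω) := by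
        ext ω
        by_cases hω : ω ∈ A
        · obtain ⟨h1, h2, h3, -⟩ := hA ω hω
          simp only [κ, hω, if_true, indicator_of_mem]
          rw [Measure.restrict_apply_univ,
            pathMeasure_Ioc h1, Real.toNNReal_zero, h2, h3]
        · simp [κ, hω]
      rw [this]
      exact (((hΓ.aemeasurable _).measurable_mk.sub
        (hΓ.aemeasurable _).measurable_mk).ennreal_ofReal).indicator mA
  -- Nothing is known of `f` on the negatives; freezing it there at `f 0` gives a globally monotone
  -- function.
  have hfm : Measurable fun x => f (max x 0) := by
    rcases hf with hf | hf
    · exact Monotone.measurable fun x y hxy =>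
        hf (le_max_right x 0) (le_max_right y 0) (max_le_max_right 0 hxy)
    · exact Antitone.measurable fun x y hxy =>
        hf (le_max_right x 0) (le_max_right y 0) (max_le_max_right 0 hxy)
  refine ⟨fun ω => (∫⁻ x, ENNReal.ofReal (f (max x 0)) ∂(κ ω)).toReal,
    ((Measure.measurable_lintegral hfm.ennreal_ofReal).comp hκ).ennreal_toReal, ?_⟩
  filter_upwards [hPA] with ω hω
  rw [← integral_eq_lintegral_of_nonneg_ae (ae_of_all _ fun x => hf0 _ (le_max_right x 0))
    hfm.aestronglyMeasurable]
  simp only [κ, hω, if_true, gammaIntegral]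
  refine setIntegral_congr_fun measurableSet_Ioc fun x hx => ?_
  simp [max_eq_left hx.1.le]

theorem aemeasurable_gammaRatio (hΓ : IsGammaProcess Γ P) {f : ℝ → ℝ}
    (hf0 : ∀ x, 0 ≤ x → 0 ≤ f x) (hf : MonotoneOn f (Ici 0) ∨ AntitoneOn f (Ici 0)) (t : ℝ) :
    AEMeasurable (gammaRatio Γ f t) P :=
  (aemeasurable_gammaIntegral hΓ hf0 hf t).div_const _

end PathMeasure

/-! ### Gamma and exponential laws -/

section Laws

/-- Exponential tilting: multiplying the density of rate `1` by `exp (θ x)` gives a constant times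
the density of rate `1 - θ`, which has mass one. -/
theorem lintegral_exp_mul_gammaMeasure {a θ : ℝ} (ha : 0 < a) (hθ : θ < 1) :
    ∫⁻ x, ENNReal.ofReal (Real.exp (θ * x)) ∂(gammaMeasure a 1) =
      ENNReal.ofReal ((1 - θ) ^ (-a)) := by
  have h1 : 0 < 1 - θ := by linarith
  rw [gammaMeasure, lintegral_withDensity_eq_lintegral_mul _ (by unfold gammaPDF; fun_prop)
    (by fun_prop)]
  have : ∀ x, (gammaPDF a 1 * fun x => ENNReal.ofReal (Real.exp (θ * x))) x =
      ENNReal.ofReal ((1 - θ) ^ (-a)) * gammaPDF a (1 - θ) x := fun x => by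
    rw [Pi.mul_apply]
    rcases lt_or_ge x 0 with hx | hx
    · simp [gammaPDF_of_neg hx]
    · rw [gammaPDF_of_nonneg hx, gammaPDF_of_nonneg hx, ← ENNReal.ofReal_mul
        (by have := Real.Gamma_pos_of_pos ha; positivity), ← ENNReal.ofReal_mul (by positivity)]
      congr 1
      have : -((1 - θ) * x) = -(1 * x) + θ * x := by ring
      rw [this, Real.exp_add, Real.one_rpow, Real.rpow_neg h1.le]
      have := (Real.rpow_pos_of_pos h1 a).ne'
      field_simp
  simp_rw [this]
  rw [lintegral_const_mul _ (by unfold gammaPDF; fun_prop), lintegral_gammaPDF_eq_one ha h1,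
    mul_one]

theorem integrable_exp_mul_gammaMeasure {a θ : ℝ} (ha : 0 < a) (hθ : θ < 1) :
    Integrable (fun x => Real.exp (θ * x)) (gammaMeasure a 1) := by
  refine ⟨by fun_prop, ?_⟩
  rw [hasFiniteIntegral_iff_ofReal (ae_of_all _ fun x => (Real.exp_pos _).le),
    lintegral_exp_mul_gammaMeasure ha hθ]
  exact ENNReal.ofReal_lt_top

theorem mgf_gammaMeasure {a θ : ℝ} (ha : 0 < a) (hθ : θ < 1) :
    ∫ x, Real.exp (θ * x) ∂(gammaMeasure a 1) = (1 - θ) ^ (-a) := by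
  rw [integral_eq_lintegral_of_nonneg_ae (ae_of_all _ fun x => (Real.exp_pos _).le) (by fun_prop),
    lintegral_exp_mul_gammaMeasure ha hθ, ENNReal.toReal_ofReal]
  exact Real.rpow_nonneg (by linarith) _

theorem memLp_id_expMeasure {p : ℝ≥0∞} (hp : p ≠ ∞) : MemLp id p (expMeasure 1) := by
  lift p to ℝ≥0 using hp
  refine memLp_of_mem_interior_integrableExpSet ?_ p
  rw [mem_interior_iff_mem_nhds]
  filter_upwards [Iio_mem_nhds (zero_lt_one' ℝ)] with θ hθ
  exact integrable_exp_mul_gammaMeasure one_pos hθ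

theorem expMeasure_Ioi_pos (x : ℝ) : 0 < (expMeasure 1) (Ioi x) := by
  have := isProbabilityMeasure_expMeasure one_pos
  rw [← compl_Iic, prob_compl_eq_one_sub measurableSet_Iic, tsub_pos_iff_lt]
  have h := cdf_expMeasure_eq one_pos x
  rw [cdf_eq_real, measureReal_def] at h
  refine (ENNReal.toReal_lt_toReal (by finiteness) (by simp)).1 ?_
  rw [h, ENNReal.toReal_one]
  split_ifs
  · linarith [Real.exp_pos (-(1 * x))]
  · exact one_pos

theorem ae_nonneg_expMeasure : ∀ᵐ x ∂(expMeasure 1), (0 : ℝ) ≤ x := by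
  have : {x : ℝ | ¬ 0 ≤ x} = Iio 0 := by ext x; simp
  rw [ae_iff, this, expMeasure, gammaMeasure, withDensity_apply _ measurableSet_Iio]
  exact lintegral_gammaPDF_of_nonpos le_rfl

variable {Ω Ω' : Type*} [MeasurableSpace Ω] [MeasurableSpace Ω'] {P : Measure Ω} {P' : Measure Ω'}
  {Γ : ℝ≥0 → Ω → ℝ} {X : ℕ → Ω → ℝ} {Y : ℕ → Ω' → ℝ}

theorem IsIIDStdExponential.aemeasurable (hX : IsIIDStdExponential X P) (k : ℕ) :
    AEMeasurable (X (k + 1)) P :=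
  (hX.law (k + 1) (by omega)).aemeasurable

theorem IsIIDStdExponential.memLp (hX : IsIIDStdExponential X P) (k : ℕ) {p : ℝ≥0∞} (hp : p ≠ ∞) :
    MemLp (X (k + 1)) p P := by
  have h := hX.law (k + 1) (by omega)
  have := memLp_id_expMeasure hp
  rw [← h.map_eq] at this
  exact (memLp_map_measure_iff aestronglyMeasurable_id h.aemeasurable).1 this

theorem IsIIDStdExponential.ae_nonneg (hX : IsIIDStdExponential X P) :
    ∀ᵐ ω ∂P, ∀ k, 1 ≤ k → 0 ≤ X k ω := by
  refine ae_all_iff.2 fun k => ?_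
  by_cases hk : 1 ≤ k
  · have h := hX.law k hk
    filter_upwards [(h.ae_iff (p := fun x => 0 ≤ x)
      (measurableSet_le measurable_const measurable_id).mem).2 ae_nonneg_expMeasure] with ω hω _
      using hω
  · exact ae_of_all _ fun _ h => absurd h hk

theorem IsIIDStdExponential.identDistrib [IsProbabilityMeasure P] [IsProbabilityMeasure P']
    (hX : IsIIDStdExponential X P) (hY : IsIIDStdExponential Y P') :
    IdentDistrib (fun ω k => X (k + 1) ω) (fun ω k => Y (k + 1) ω) P P' where
  aemeasurable_fst := aemeasurable_pi_lambda _ hX.aemeasurable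
  aemeasurable_snd := aemeasurable_pi_lambda _ hY.aemeasurable
  map_eq := by
    rw [hX.indep.map_fun_eq_infinitePi_map₀ (aemeasurable_pi_lambda _ hX.aemeasurable),
      hY.indep.map_fun_eq_infinitePi_map₀ (aemeasurable_pi_lambda _ hY.aemeasurable)]
    simp_rw [(hX.law _ (Nat.le_add_left 1 _)).map_eq, (hY.law _ (Nat.le_add_left 1 _)).map_eq]

theorem IsIIDStdExponential.shift (hX : IsIIDStdExponential X P) :
    IsIIDStdExponential (fun k => X (k + 1)) P where
  indep := hX.indep.precomp (g := fun k => k + 1) (add_left_injective 1)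
  law k _ := hX.law (k + 1) (by omega)

theorem IsGammaProcess.isIIDStdExponential (hΓ : IsGammaProcess Γ P) :
    IsIIDStdExponential (fun k ω => Γ k ω - Γ ((k - 1 : ℕ) : ℝ≥0) ω) P where
  indep := by
    simpa using hΓ.indep.nat (t := fun k => (k : ℝ≥0)) Nat.mono_cast
  law k hk := by
    obtain ⟨k, rfl⟩ := Nat.exists_eq_add_of_le' hk
    have := hΓ.law k (k + 1 : ℕ) (by simp)
    simpa [expMeasure] using this

/-- The Laplace transform of a linear combination of increments over a regular grid. -/
theorem IsGammaProcess.integral_exp_neg_sum (hΓ : IsGammaProcess Γ P) {h : ℝ≥0} (hh : 0 < h)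
    (n : ℕ) {c : ℕ → ℝ} (hc : ∀ i, 0 ≤ c i) :
    ∫ ω, Real.exp (-∑ i ∈ Finset.range n, c i * (Γ (h * (i + 1)) ω - Γ (h * i) ω)) ∂P =
      Real.exp (-∑ i ∈ Finset.range n, Real.log (1 + c i) * h) := by
  have hind := hΓ.indep.nat (t := fun i : ℕ => h * i)
    (fun i j hij => mul_le_mul_right (Nat.cast_le.2 hij) h)
  have hlaw : ∀ i : ℕ, HasLaw (fun ω => Γ (h * (i + 1)) ω - Γ (h * i) ω) (gammaMeasure h 1) P := by
    intro i
    have := hΓ.law (h * i) (h * (i + 1)) (by gcongr; simp)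
    convert! this using 2
    push_cast
    ring
  have h1 : ∀ i : ℕ, ∫ ω, Real.exp (-c i * (Γ (h * (i + 1)) ω - Γ (h * i) ω)) ∂P =
      Real.exp (-(Real.log (1 + c i) * h)) := by
    intro i
    have := (hlaw i).integral_comp (f := fun x => Real.exp (-c i * x)) (by fun_prop)
    rw [Function.comp_def] at this
    rw [this, mgf_gammaMeasure (by exact_mod_cast hh) (by linarith [hc i]), sub_neg_eq_add,
      Real.rpow_def_of_pos (by linarith [hc i])]
    ring_nf
  simp_rw [← Finset.sum_neg_distrib, Real.exp_sum, ← neg_mul] at h1 ⊢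
  simp_rw [← h1]
  have hi2 : iIndepFun (fun (i : Fin n) ω => Γ (h * ((i : ℕ) + 1)) ω - Γ (h * (i : ℕ)) ω) P := by
    have := hind.precomp (g := fun i : Fin n => (i : ℕ)) Fin.val_injective
    simpa using this
  have := hi2.integral_fun_prod_comp (f := fun (i : Fin n) x => Real.exp (-c i * x))
    (fun i => (hlaw i).aemeasurable) (fun i => by fun_prop)
  rw [Finset.prod_range, ← this]
  congr with ω
  rw [Finset.prod_range]

end Laws

/-! ### Failure of convergence in measure -/

section Laplace

variable {f : ℝ → ℝ}

theorem monotoneOn_or_antitoneOn_comp {φ : ℝ → ℝ} (hφ : MonotoneOn φ (Ici 0))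
    (hf0 : ∀ x, 0 ≤ x → 0 ≤ f x) (hf : MonotoneOn f (Ici 0) ∨ AntitoneOn f (Ici 0)) :
    MonotoneOn (fun x => φ (f x)) (Ici 0) ∨ AntitoneOn (fun x => φ (f x)) (Ici 0) :=
  hf.imp (fun h _ hx _ hy hxy => hφ (hf0 _ hx) (hf0 _ hy) (h hx hy hxy))
    (fun h _ hx _ hy hxy => hφ (hf0 _ hy) (hf0 _ hx) (h hx hy hxy))

theorem monotoneOn_log_one_add : MonotoneOn (fun x => Real.log (1 + x)) (Ici 0) :=
  fun x (hx : 0 ≤ x) _ _ hxy => Real.log_le_log (by linarith) (by linarith)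

/-- Upper Riemann sums of a monotone function, with control of the logarithmic sums. -/
theorem exists_upper_sum (hf0 : ∀ x, 0 ≤ x → 0 ≤ f x)
    (hf : MonotoneOn f (Ici 0) ∨ AntitoneOn f (Ici 0)) {h : ℝ} (hh : 0 ≤ h) (n : ℕ) :
    ∃ c : ℕ → ℝ, (∀ i, 0 ≤ c i) ∧
      (∀ μ : Measure ℝ, IsLocallyFiniteMeasure μ → ∫ x in Ioc 0 (h * n), f x ∂μ ≤
        ∑ i ∈ Finset.range n, c i * μ.real (Ioc (h * i) (h * (i + 1)))) ∧
      ∑ i ∈ Finset.range n, Real.log (1 + c i) * h ≤ (∫ x in Ioc 0 (h * n), Real.log (1 + f x)) +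
        h * (Real.log (1 + f 0) + Real.log (1 + f (h * n))) := by
  have hlog : ∀ x, 0 ≤ x → 0 ≤ Real.log (1 + f x) := fun x hx =>
    Real.log_nonneg (by linarith [hf0 x hx])
  have hvol : ∀ i : ℕ, (volume : Measure ℝ).real (Ioc (h * i) (h * (i + 1))) = h := fun i => by
    rw [Real.volume_real_Ioc_of_le (by nlinarith)]
    ring
  -- Left- and right-endpoint sums of `log (1 + f)` differ by a telescoping boundary term, the
  -- source of the error in the bound. The `c i` must not depend on `μ`, since they serve all random
  -- path measures at once.
  have htel := Finset.sum_range_sub (fun i : ℕ => Real.log (1 + f (h * i))) n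
  rw [Finset.sum_sub_distrib] at htel
  push_cast at htel
  rw [mul_zero] at htel
  have h0 := hlog 0 le_rfl
  have hn := hlog (h * n) (by positivity)
  rcases hf with hf | hf
  · refine ⟨fun i => f (h * (i + 1)), fun i => hf0 _ (by positivity), fun μ _ =>
      hf.setIntegral_Ioc_le_sum hh n, ?_⟩
    have hφ : MonotoneOn (fun x => Real.log (1 + f x)) (Ici 0) := fun x hx y hy hxy =>
      monotoneOn_log_one_add (hf0 x hx) (hf0 y hy) (hf hx hy hxy)
    have := hφ.sum_le_setIntegral_Ioc (μ := volume) hh n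
    simp_rw [hvol, ← Finset.sum_mul] at this
    rw [← Finset.sum_mul]
    nlinarith
  · refine ⟨fun i => f (h * i), fun i => hf0 _ (by positivity), fun μ _ =>
      hf.setIntegral_Ioc_le_sum hh n, ?_⟩
    have hφ : AntitoneOn (fun x => Real.log (1 + f x)) (Ici 0) := fun x hx y hy hxy =>
      monotoneOn_log_one_add (hf0 y hy) (hf0 x hx) (hf hx hy hxy)
    have := hφ.sum_le_setIntegral_Ioc (μ := volume) hh n
    simp_rw [hvol, ← Finset.sum_mul] at this
    rw [← Finset.sum_mul]
    nlinarith

variable {Ω : Type*} [MeasurableSpace Ω] {P : Measure Ω} [IsProbabilityMeasure P]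
  {Γ : ℝ≥0 → Ω → ℝ}

theorem integrable_exp_neg_of_nonneg {Y : Ω → ℝ} (hY : AEMeasurable Y P) (h0 : ∀ ω, 0 ≤ Y ω) :
    Integrable (fun ω => Real.exp (-Y ω)) P := by
  refine Integrable.of_bound (C := 1) hY.neg.exp.aestronglyMeasurable (ae_of_all _ fun ω => ?_)
  rw [Real.norm_eq_abs, Real.abs_exp, Real.exp_le_one_iff]
  linarith [h0 ω]

/-- Half of the Laplace functional formula for the Gamma process. -/
theorem IsGammaProcess.exp_neg_integral_log_le (hΓ : IsGammaProcess Γ P)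
    (hf0 : ∀ x, 0 ≤ x → 0 ≤ f x) (hf : MonotoneOn f (Ici 0) ∨ AntitoneOn f (Ici 0)) {t : ℝ}
    (ht : 0 < t) :
    Real.exp (-∫ x in Ioc 0 t, Real.log (1 + f x)) ≤
      ∫ ω, Real.exp (-gammaIntegral Γ f t ω) ∂P := by
  -- The upper sum dominates the integral pathwise and has an explicit Laplace transform; the
  -- boundary error vanishes with the mesh `t / n`.
  have key : ∀ n : ℕ, 0 < n → Real.exp (-((∫ x in Ioc 0 t, Real.log (1 + f x)) +
      t / n * (Real.log (1 + f 0) + Real.log (1 + f t)))) ≤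
      ∫ ω, Real.exp (-gammaIntegral Γ f t ω) ∂P := by
    intro n hn
    have hn' : (0 : ℝ) < n := by exact_mod_cast hn
    have hh : 0 < t / n := by positivity
    have hhn : t / n * n = t := by field_simp
    obtain ⟨c, hc0, hc1, hc2⟩ := exists_upper_sum hf0 hf hh.le n
    rw [hhn] at hc1 hc2
    have hL := hΓ.integral_exp_neg_sum (h := (t / n).toNNReal) (by simpa using hh) n hc0
    rw [Real.coe_toNNReal _ hh.le] at hL
    refine (Real.exp_le_exp.2 (neg_le_neg hc2)).trans (hL.symm.le.trans ?_)
    refine integral_mono_of_nonneg (ae_of_all _ fun ω => (Real.exp_pos _).le)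
      (integrable_exp_neg_of_nonneg (aemeasurable_gammaIntegral hΓ hf0 hf t)
        (gammaIntegral_nonneg hf0 t)) ?_
    filter_upwards [hΓ.path] with ω hω
    refine Real.exp_le_exp.2 (neg_le_neg ((hc1 _ inferInstance).trans (le_of_eq ?_)))
    refine Finset.sum_congr rfl fun i _ => ?_
    rw [pathMeasure_real_Ioc hω (by gcongr; linarith), Real.toNNReal_mul hh.le,
      Real.toNNReal_mul hh.le, Real.toNNReal_add (by positivity) zero_le_one,
      Real.toNNReal_natCast, Real.toNNReal_one]
  have hlim : Tendsto (fun n : ℕ => Real.exp (-((∫ x in Ioc 0 t, Real.log (1 + f x)) +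
      t / n * (Real.log (1 + f 0) + Real.log (1 + f t))))) atTop
      (𝓝 (Real.exp (-((∫ x in Ioc 0 t, Real.log (1 + f x)) +
      0 * (Real.log (1 + f 0) + Real.log (1 + f t)))))) :=
    (Real.continuous_exp.tendsto _).comp
      (((tendsto_const_div_atTop_nhds_zero_nat t).mul_const _).const_add _).neg
  rw [zero_mul, add_zero] at hlim
  exact le_of_tendsto hlim (by filter_upwards [eventually_gt_atTop 0] with n hn using key n hn)

theorem gammaRatio_eq_gammaIntegral_div {Ω : Type*} (Γ : ℝ≥0 → Ω → ℝ) (f : ℝ → ℝ) {t : ℝ}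
    (ht : 0 ≤ t) (ω : Ω) :
    gammaRatio Γ f t ω = gammaIntegral Γ f t ω / ∫ x in Ioc 0 t, f x := by
  rw [gammaRatio, intervalIntegral.integral_of_le ht]

/-- Concentration of the ratio near `1` would bring `E exp(-R_t)` close to `exp(-1)`, while the
Laplace bound for `f / L` keeps it at least `exp(-1 + κ)`. -/
theorem IsGammaProcess.not_null_of_frequently_integral_log_le (hΓ : IsGammaProcess Γ P)
    (hf0 : ∀ x, 0 ≤ x → 0 ≤ f x) (hf : MonotoneOn f (Ici 0) ∨ AntitoneOn f (Ici 0)) {κ : ℝ}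
    (hκ : 0 < κ)
    (h : ∃ᶠ t in atTop, ∫ x in Ioc 0 t, Real.log (1 + f x / ∫ y in Ioc 0 t, f y) ≤ 1 - κ) :
    ¬ ConvMode.inMeasure.Null P atTop (fun t ω => gammaRatio Γ f t ω - 1) := by
  intro hnull
  rw [ConvMode.null_inMeasure_iff] at hnull
  have hd : 0 < Real.exp (-1 + κ) - Real.exp (-1 + κ / 2) :=
    sub_pos.2 (Real.exp_lt_exp.2 (by linarith))
  have hev := (hnull (κ / 2) (by positivity)).eventually_lt_const (ENNReal.ofReal_pos.2 hd)
  obtain ⟨t, ht1, ht2, ht⟩ := (h.and_eventually (hev.and (eventually_gt_atTop 0))).exists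
  set L := ∫ y in Ioc 0 t, f y with hL
  have hL0 : 0 ≤ L := setIntegral_nonneg measurableSet_Ioc fun x hx => hf0 x hx.1.le
  have hg0 : ∀ x, 0 ≤ x → 0 ≤ f x / L := fun x hx => div_nonneg (hf0 x hx) hL0
  have hg := monotoneOn_or_antitoneOn_comp (φ := fun x => x / L)
    (fun x _ y _ hxy => div_le_div_of_nonneg_right hxy hL0) hf0 hf
  have h1 := hΓ.exp_neg_integral_log_le hg0 hg ht
  have h2 : ∀ ω, gammaIntegral Γ (fun x => f x / L) t ω = gammaRatio Γ f t ω := fun ω => by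
    rw [gammaRatio_eq_gammaIntegral_div Γ f ht.le, gammaIntegral, integral_div, ← hL,
      gammaIntegral]
  simp_rw [h2] at h1
  have hR0 : ∀ ω, 0 ≤ gammaRatio Γ f t ω := fun ω => by
    rw [← h2]; exact gammaIntegral_nonneg hg0 t ω
  have mR := aemeasurable_gammaRatio hΓ hf0 hf t
  set A : Set Ω := {ω | κ / 2 ≤ |gammaRatio Γ f t ω - 1|} with hA
  have mA : NullMeasurableSet A P :=
    nullMeasurableSet_le aemeasurable_const (by fun_prop)
  -- Off `A` the ratio exceeds `1 - κ/2`; on `A` the exponential is at most `1`, and `A` was made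
  -- less likely than the gap `hd`.
  have h3 : ∫ ω, Real.exp (-gammaRatio Γ f t ω) ∂P ≤
      ∫ ω, (Real.exp (-1 + κ / 2) + A.indicator (fun _ => (1 : ℝ)) ω) ∂P := by
    have hi : Integrable (A.indicator fun _ => (1 : ℝ)) P :=
      (integrable_const (1 : ℝ)).indicator₀ mA
    refine integral_mono (integrable_exp_neg_of_nonneg mR hR0) ((integrable_const _).add hi)
      fun ω => ?_
    by_cases hω : ω ∈ A
    · have : Real.exp (-gammaRatio Γ f t ω) ≤ 1 := by
        rw [Real.exp_le_one_iff]; linarith [hR0 ω]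
      simp only [hω, indicator_of_mem]
      linarith [Real.exp_pos (-1 + κ / 2)]
    · simp only [hω, not_false_eq_true, indicator_of_notMem, add_zero]
      have : |gammaRatio Γ f t ω - 1| < κ / 2 := not_le.1 hω
      exact Real.exp_le_exp.2 (by linarith [(abs_lt.1 this).1])
  rw [integral_add (integrable_const _) ((integrable_const (1 : ℝ)).indicator₀ mA),
    integral_indicator₀ mA] at h3
  simp only [integral_const, probReal_univ, smul_eq_mul, mul_one,
    measureReal_restrict_apply_univ] at h3
  have h4 : P.real A < Real.exp (-1 + κ) - Real.exp (-1 + κ / 2) := by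
    rw [measureReal_def]
    exact (ENNReal.lt_ofReal_iff_toReal_lt (by finiteness)).1 ht2
  have h5 : Real.exp (-1 + κ) ≤ Real.exp (-∫ x in Ioc 0 t, Real.log (1 + f x / L)) :=
    Real.exp_le_exp.2 (by linarith)
  linarith

/-- By concavity `log (1 + g)` lies below its tangent at `c`. The second term of the minimum makes
`(1 - δ) g` larger at `c`; the first makes its slope at least the tangent slope `1 / (1 + c)`. -/
theorem exists_log_one_add_le {c : ℝ} (hc : 0 < c) :
    ∃ δ > 0, ∀ g, c ≤ g → Real.log (1 + g) ≤ (1 - δ) * g := by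
  have hd : 0 < c - Real.log (1 + c) := by
    have := Real.log_lt_sub_one_of_pos (x := 1 + c) (by linarith) (by linarith)
    linarith
  refine ⟨min (c / (1 + c)) ((c - Real.log (1 + c)) / c), by positivity, fun g hg => ?_⟩
  set δ := min (c / (1 + c)) ((c - Real.log (1 + c)) / c)
  have h1 : δ ≤ c / (1 + c) := min_le_left _ _
  have h2 : δ * c ≤ c - Real.log (1 + c) := (le_div_iff₀ hc).1 (min_le_right _ _)
  have h3 : Real.log (1 + g) ≤ (g - c) / (1 + c) + Real.log (1 + c) := by
    have h4 := Real.log_le_sub_one_of_pos (x := (1 + g) / (1 + c)) (by apply div_pos <;> linarith)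
    rw [Real.log_div (by linarith) (by linarith)] at h4
    have : (1 + g) / (1 + c) - 1 = (g - c) / (1 + c) := by
      field_simp
      ring
    linarith
  have h5 : (g - c) / (1 + c) = (g - c) - (g - c) * (c / (1 + c)) := by
    field_simp
    ring
  nlinarith

/-- The saving comes from `(a, b]` alone; elsewhere `log (1 + x) ≤ x` suffices. -/
theorem setIntegral_log_le (hf0 : ∀ x, 0 ≤ x → 0 ≤ f x)
    (hf : MonotoneOn f (Ici 0) ∨ AntitoneOn f (Ici 0)) {c δ : ℝ}
    (hδ : ∀ g, c ≤ g → Real.log (1 + g) ≤ (1 - δ) * g) {a b t : ℝ} (ha : 0 ≤ a) (hab : a ≤ b)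
    (hbt : b ≤ t) (hc : ∀ x ∈ Ioc a b, c ≤ f x) :
    ∫ x in Ioc 0 t, Real.log (1 + f x) ≤ (∫ x in Ioc 0 t, f x) - δ * ∫ x in Ioc a b, f x := by
  have hφ := monotoneOn_or_antitoneOn_comp monotoneOn_log_one_add hf0 hf
  have hle : ∀ x y : ℝ, 0 ≤ x → ∫ z in Ioc x y, Real.log (1 + f z) ≤ ∫ z in Ioc x y, f z := by
    intro x y hx
    refine setIntegral_mono_on (integrableOn_Ioc_of_monotoneOn_or_antitoneOn hφ hx)
      (integrableOn_Ioc_of_monotoneOn_or_antitoneOn hf hx) measurableSet_Ioc fun z hz => ?_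
    have := hf0 z (hx.trans hz.1.le)
    linarith [Real.log_le_sub_one_of_pos (x := 1 + f z) (by linarith)]
  have hmid : ∫ z in Ioc a b, Real.log (1 + f z) ≤ (1 - δ) * ∫ z in Ioc a b, f z := by
    rw [← integral_const_mul]
    exact setIntegral_mono_on (integrableOn_Ioc_of_monotoneOn_or_antitoneOn hφ ha)
      ((integrableOn_Ioc_of_monotoneOn_or_antitoneOn hf ha).const_mul _) measurableSet_Ioc
      fun z hz => hδ _ (hc z hz)
  rw [setIntegral_Ioc_add hφ le_rfl (ha.trans hab) hbt, setIntegral_Ioc_add hφ le_rfl ha hab,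
    setIntegral_Ioc_add hf le_rfl (ha.trans hab) hbt, setIntegral_Ioc_add hf le_rfl ha hab]
  linarith [hle 0 a le_rfl, hle b t (ha.trans hab)]

/-- If a fixed proportion of the mass of `f` on `(0, t]` is frequently carried by an interval where
`f` exceeds a fixed multiple of that mass, then the ratio does not converge in probability. -/
theorem IsGammaProcess.not_null_of_frequently (hΓ : IsGammaProcess Γ P)
    (hf0 : ∀ x, 0 ≤ x → 0 ≤ f x) (hf : MonotoneOn f (Ici 0) ∨ AntitoneOn f (Ici 0)) {c η : ℝ}
    (hc : 0 < c) (hη : 0 < η)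
    (h : ∃ᶠ t in atTop, (0 < ∫ y in Ioc 0 t, f y) ∧ ∃ a b, 0 ≤ a ∧ a ≤ b ∧ b ≤ t ∧
      (∀ x ∈ Ioc a b, (c * ∫ y in Ioc 0 t, f y) ≤ f x) ∧
      (η * ∫ y in Ioc 0 t, f y) ≤ ∫ y in Ioc a b, f y) :
    ¬ ConvMode.inMeasure.Null P atTop (fun t ω => gammaRatio Γ f t ω - 1) := by
  obtain ⟨δ, hδ0, hδ⟩ := exists_log_one_add_le hc
  refine hΓ.not_null_of_frequently_integral_log_le hf0 hf (κ := δ * η) (by positivity) ?_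
  refine h.mono fun t ⟨hL0, a, b, ha, hab, hbt, h1, h2⟩ => ?_
  set L := ∫ y in Ioc 0 t, f y with hL
  have hg0 : ∀ x, 0 ≤ x → 0 ≤ f x / L := fun x hx => div_nonneg (hf0 x hx) hL0.le
  have hg := monotoneOn_or_antitoneOn_comp (φ := fun x => x / L)
    (fun x _ y _ hxy => div_le_div_of_nonneg_right hxy hL0.le) hf0 hf
  have := setIntegral_log_le hg0 hg hδ ha hab hbt fun x hx => (le_div_iff₀ hL0).2 (h1 x hx)
  rw [integral_div, integral_div, ← hL, div_self hL0.ne'] at this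
  refine this.trans ?_
  have : η ≤ (∫ x in Ioc a b, f x) / L := (le_div_iff₀ hL0).2 h2
  nlinarith

end Laplace

/-! ### Failure of convergence in probability for the weighted sums -/

section Discrete

variable {Ω : Type*} [MeasurableSpace Ω] {P : Measure Ω}
  {X : ℕ → Ω → ℝ} {w : ℕ → ℝ}

/-- This handles vanishing denominators, where the quotient is read as `0`. -/
theorem not_null_of_frequently_eq_neg_one [IsProbabilityMeasure P] {ι : Type*} {l : Filter ι}
    {Y : ι → Ω → ℝ} (h : ∃ᶠ i in l, ∀ ω, Y i ω = -1) : ¬ ConvMode.inMeasure.Null P l Y := by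
  intro hnull
  rw [ConvMode.null_inMeasure_iff] at hnull
  obtain ⟨i, h1, h2⟩ :=
    (h.and_eventually ((hnull 1 one_pos).eventually_lt_const one_pos)).exists
  simp [h1] at h2

/-- If `X k > 2 / c` for the heavy index `k`, that summand alone pushes the ratio above `2`. The
probability of this event is positive and the same for all `n` and `k`. -/
theorem IsIIDStdExponential.not_null_of_frequently (hX : IsIIDStdExponential X P)
    (hw : ∀ k, 0 ≤ w k) {c : ℝ} (hc : 0 < c)
    (h : ∃ᶠ n in atTop, (0 < ∑ k ∈ Finset.Icc 1 n, w k) ∧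
      ∃ k ∈ Finset.Icc 1 n, (c * ∑ k ∈ Finset.Icc 1 n, w k) ≤ w k) :
    ¬ ConvMode.inMeasure.Null P atTop (fun n ω => weightedRatio w X n ω - 1) := by
  intro hnull
  rw [ConvMode.null_inMeasure_iff] at hnull
  obtain ⟨n, ⟨hW, k, hk, hck⟩, h2⟩ := (h.and_eventually
    ((hnull 1 one_pos).eventually_lt_const (expMeasure_Ioi_pos (2 / c)))).exists
  refine h2.not_ge ?_
  have hlaw := hX.law k (Finset.mem_Icc.1 hk).1
  rw [← hlaw.map_eq, Measure.map_apply_of_aemeasurable hlaw.aemeasurable measurableSet_Ioi]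
  refine measure_mono_ae ?_
  filter_upwards [hX.ae_nonneg] with ω hω
  intro (hx : 2 / c < X k ω)
  change 1 ≤ |weightedRatio w X n ω - 1|
  have h3 : w k * X k ω ≤ ∑ k ∈ Finset.Icc 1 n, w k * X k ω :=
    Finset.single_le_sum (f := fun k => w k * X k ω)
      (fun i hi => mul_nonneg (hw i) (hω i (Finset.mem_Icc.1 hi).1)) hk
  have h4 : 2 ≤ weightedRatio w X n ω := by
    rw [weightedRatio, le_div_iff₀ hW]
    rw [div_lt_iff₀ hc] at hx
    have h5 := hω k (Finset.mem_Icc.1 hk).1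
    nlinarith
  exact le_trans (by linarith) (le_abs_self _)

end Discrete

/-! ### Comparison of the Gamma integral with weighted sums -/

section Comparison

/-- The weights `f 1 + ⋯ + f n`. -/
noncomputable def weightSum (f : ℝ → ℝ) (n : ℕ) : ℝ := ∑ k ∈ Finset.Icc 1 n, f k

theorem sum_Icc_one_eq_sum_range (g : ℕ → ℝ) (n : ℕ) :
    ∑ k ∈ Finset.Icc 1 n, g k = ∑ i ∈ Finset.range n, g (i + 1) := by
  induction n with
  | zero => simp
  | succ n ih => rw [Finset.sum_Icc_succ_top (by omega), ih, Finset.sum_range_succ]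

theorem weightSum_succ (f : ℝ → ℝ) (n : ℕ) :
    weightSum f (n + 1) = weightSum f n + f ((n + 1 : ℕ) : ℝ) :=
  Finset.sum_Icc_succ_top (by omega) _

variable {f : ℝ → ℝ}

theorem sum_range_add_last (f : ℝ → ℝ) (n : ℕ) :
    ∑ i ∈ Finset.range n, f i + f n = f 0 + weightSum f n := by
  rw [weightSum, sum_Icc_one_eq_sum_range (fun k => f k), ← Finset.sum_range_succ,
    Finset.sum_range_succ']
  simp [add_comm]

theorem MonotoneOn.setIntegral_le_weightSum (hf : MonotoneOn f (Ici 0)) (n : ℕ) :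
    ∫ x in Ioc 0 (n : ℝ), f x ≤ weightSum f n := by
  have := hf.setIntegral_Ioc_le_sum (μ := volume) zero_le_one n
  rw [weightSum, sum_Icc_one_eq_sum_range (fun k => f k)]
  simpa using this

theorem MonotoneOn.sum_range_le_setIntegral (hf : MonotoneOn f (Ici 0)) (n : ℕ) :
    ∑ i ∈ Finset.range n, f i ≤ ∫ x in Ioc 0 (n : ℝ), f x := by
  simpa using hf.sum_le_setIntegral_Ioc (μ := volume) zero_le_one n

theorem AntitoneOn.weightSum_le_setIntegral (hf : AntitoneOn f (Ici 0)) (n : ℕ) :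
    weightSum f n ≤ ∫ x in Ioc 0 (n : ℝ), f x := by
  have := hf.sum_le_setIntegral_Ioc (μ := volume) zero_le_one n
  rw [weightSum, sum_Icc_one_eq_sum_range (fun k => f k)]
  simpa using this

theorem AntitoneOn.setIntegral_le_sum_range (hf : AntitoneOn f (Ici 0)) (n : ℕ) :
    ∫ x in Ioc 0 (n : ℝ), f x ≤ ∑ i ∈ Finset.range n, f i := by
  simpa using hf.setIntegral_Ioc_le_sum (μ := volume) zero_le_one n

/-- The integral lies between the endpoint sums `weightSum f n` and `weightSum f n + f 0 - f n`. -/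
theorem abs_setIntegral_sub_weightSum_le (hf0 : ∀ x, 0 ≤ x → 0 ≤ f x)
    (hf : MonotoneOn f (Ici 0) ∨ AntitoneOn f (Ici 0)) (n : ℕ) :
    |(∫ x in Ioc 0 (n : ℝ), f x) - weightSum f n| ≤ f 0 + f n := by
  have h0 := hf0 0 le_rfl
  have hn := hf0 n (by positivity)
  have hs := sum_range_add_last f n
  rw [abs_le]
  rcases hf with hf | hf
  · have h1 := hf.setIntegral_le_weightSum n
    have h2 := hf.sum_range_le_setIntegral n
    constructor <;> linarith
  · have h1 := hf.weightSum_le_setIntegral n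
    have h2 := hf.setIntegral_le_sum_range n
    constructor <;> linarith

/-- The weights sum to infinity and each is asymptotically negligible with respect to the sum. -/
structure NegligibleWeights (f : ℝ → ℝ) : Prop where
  tendsto_weightSum : Tendsto (weightSum f) atTop atTop
  tendsto_div : Tendsto (fun n : ℕ => f n / weightSum f n) atTop (𝓝 0)

namespace NegligibleWeights

theorem tendsto_weightSum_div_succ (h : NegligibleWeights f) :
    Tendsto (fun n => weightSum f n / weightSum f (n + 1)) atTop (𝓝 1) := by
  have h1 := ((h.tendsto_div.comp (tendsto_add_atTop_nat 1)).const_sub 1)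
  rw [sub_zero] at h1
  refine h1.congr' ?_
  filter_upwards [(h.tendsto_weightSum.comp (tendsto_add_atTop_nat 1)).eventually_gt_atTop 0]
    with n hn
  simp only [Function.comp_apply] at hn ⊢
  rw [eq_div_iff hn.ne', sub_mul, div_mul_cancel₀ _ hn.ne', weightSum_succ]
  ring

theorem tendsto_setIntegral_div (h : NegligibleWeights f) (hf0 : ∀ x, 0 ≤ x → 0 ≤ f x)
    (hf : MonotoneOn f (Ici 0) ∨ AntitoneOn f (Ici 0)) :
    Tendsto (fun n : ℕ => (∫ x in Ioc 0 (n : ℝ), f x) / weightSum f n) atTop (𝓝 1) := by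
  have h1 : Tendsto (fun n : ℕ => f 0 / weightSum f n + f n / weightSum f n) atTop (𝓝 0) := by
    simpa using (h.tendsto_weightSum.const_div_atTop (f 0)).add h.tendsto_div
  rw [← tendsto_sub_nhds_zero_iff]
  refine squeeze_zero_norm' ?_ h1
  filter_upwards [h.tendsto_weightSum.eventually_gt_atTop 0] with n hn
  have h2 := abs_setIntegral_sub_weightSum_le hf0 hf n
  rw [Real.norm_eq_abs, div_sub_one hn.ne', abs_div, abs_of_pos hn, ← add_div]
  gcongr

theorem tendsto_setIntegral_succ_div (h : NegligibleWeights f) (hf0 : ∀ x, 0 ≤ x → 0 ≤ f x)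
    (hf : MonotoneOn f (Ici 0) ∨ AntitoneOn f (Ici 0)) :
    Tendsto (fun n : ℕ => (∫ x in Ioc 0 ((n + 1 : ℕ) : ℝ), f x) / weightSum f n) atTop (𝓝 1) := by
  have h1 := ((h.tendsto_setIntegral_div hf0 hf).comp (tendsto_add_atTop_nat 1)).div
    h.tendsto_weightSum_div_succ one_ne_zero
  rw [div_one] at h1
  refine h1.congr' ?_
  filter_upwards [h.tendsto_weightSum.eventually_gt_atTop 0,
    (h.tendsto_weightSum.comp (tendsto_add_atTop_nat 1)).eventually_gt_atTop 0] with n h2 h3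
  simp only [Function.comp_apply, Pi.div_apply] at h3 ⊢
  field_simp

theorem tendsto_setIntegral (h : NegligibleWeights f) (hf0 : ∀ x, 0 ≤ x → 0 ≤ f x)
    (hf : MonotoneOn f (Ici 0) ∨ AntitoneOn f (Ici 0)) :
    Tendsto (fun n : ℕ => ∫ x in Ioc 0 (n : ℝ), f x) atTop atTop := by
  refine ((h.tendsto_setIntegral_div hf0 hf).pos_mul_atTop one_pos h.tendsto_weightSum).congr' ?_
  filter_upwards [h.tendsto_weightSum.eventually_gt_atTop 0] with n hn
  rw [div_mul_cancel₀ _ hn.ne']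

end NegligibleWeights

theorem setIntegral_mono_right {μ : Measure ℝ} [IsLocallyFiniteMeasure μ]
    (hf0 : ∀ x, 0 ≤ x → 0 ≤ f x) (hf : MonotoneOn f (Ici 0) ∨ AntitoneOn f (Ici 0)) {s t : ℝ}
    (hst : s ≤ t) : ∫ x in Ioc 0 s, f x ∂μ ≤ ∫ x in Ioc 0 t, f x ∂μ :=
  setIntegral_mono_set (integrableOn_Ioc_of_monotoneOn_or_antitoneOn hf le_rfl)
    ((ae_restrict_iff' measurableSet_Ioc).2 (ae_of_all _ fun x hx => hf0 x hx.1.le))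
    (Ioc_subset_Ioc_right hst).eventuallyLE

variable {Ω Ω' : Type*} [MeasurableSpace Ω] [MeasurableSpace Ω'] {P : Measure Ω} {P' : Measure Ω'}
  [IsProbabilityMeasure P] [IsProbabilityMeasure P']
  {Γ : ℝ≥0 → Ω → ℝ} {m : ConvMode}

namespace ConvMode

theorem Null.mul_sub_one {Y : ℕ → Ω → ℝ} (hm : m.Admissible)
    (h : m.Null P atTop (fun n ω => Y n ω - 1)) (mY : ∀ n, AEMeasurable (Y n) P) {u : ℕ → ℝ}
    (hu : Tendsto u atTop (𝓝 1)) : m.Null P atTop (fun n ω => u n * Y n ω - 1) := by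
  have h1 := (h.mul_of_tendsto hu).add (null_const hm (P := P) (tendsto_sub_nhds_zero_iff.2 hu))
    (fun n => ((mY n).sub_const 1).const_mul (u n)) (fun n => aemeasurable_const)
  refine h1.mono univ_mem (ae_of_all _ fun ω n _ => le_of_eq ?_)
  ring_nf

omit [IsProbabilityMeasure P] in
theorem Null.abs {ι : Type*} {l : Filter ι} {Y : ι → Ω → ℝ} (h : m.Null P l Y) :
    m.Null P l (fun n ω => |Y n ω|) :=
  h.mono univ_mem (ae_of_all _ fun _ _ _ => (abs_abs _).le)

end ConvMode

namespace IsIIDStdExponential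

variable {X Y Z : ℕ → Ω → ℝ} {X' : ℕ → Ω' → ℝ} {w : ℕ → ℝ}

omit [IsProbabilityMeasure P] in
theorem aemeasurable_weightedRatio (hX : IsIIDStdExponential X P) (w : ℕ → ℝ) (n : ℕ) :
    AEMeasurable (weightedRatio w X n) P := by
  unfold weightedRatio
  refine AEMeasurable.div_const (Finset.aemeasurable_fun_sum _ fun k hk => ?_) _
  exact (hX.law k (Finset.mem_Icc.1 hk).1).aemeasurable.const_mul _

theorem null_comp_weightedRatio_iff (hX : IsIIDStdExponential X P)
    (hX' : IsIIDStdExponential X' P') {φ : ℝ → ℝ} (hφ : Measurable φ) :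
    m.Null P atTop (fun n ω => φ (weightedRatio w X n ω)) ↔
      m.Null P' atTop (fun n ω => φ (weightedRatio w X' n ω)) := by
  have hg : ∀ n : ℕ, Measurable fun x : ℕ → ℝ => φ ((∑ i ∈ Finset.range n, w (i + 1) * x i) /
      ∑ k ∈ Finset.Icc 1 n, w k) := fun n => by fun_prop
  have h1 := hX.identDistrib hX'
  have e1 : ∀ n ω, (∑ i ∈ Finset.range n, w (i + 1) * X (i + 1) ω) / ∑ k ∈ Finset.Icc 1 n, w k =
      weightedRatio w X n ω := fun n ω => by
    rw [weightedRatio, sum_Icc_one_eq_sum_range (fun k => w k * X k ω)]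
  have e2 : ∀ n ω, (∑ i ∈ Finset.range n, w (i + 1) * X' (i + 1) ω) / ∑ k ∈ Finset.Icc 1 n, w k =
      weightedRatio w X' n ω := fun n ω => by
    rw [weightedRatio, sum_Icc_one_eq_sum_range (fun k => w k * X' k ω)]
  constructor <;> intro h
  · have := ConvMode.Null.of_identDistrib h1 hg (m := m)
    simp only [e1, e2] at this
    exact this h
  · have := ConvMode.Null.of_identDistrib h1.symm hg (m := m)
    simp only [e1, e2] at this
    exact this h

/-- The Gamma integral bounds one exponential sequence from one side and its shift from the other.
Each one-sided deviation depends only on the law, so both can be moved to a common sequence and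
added. -/
theorem null_weightedRatio_sub_one_of_posPart (hX : IsIIDStdExponential X P)
    (hX' : IsIIDStdExponential X' P') (hY : IsIIDStdExponential Y P)
    (hZ : IsIIDStdExponential Z P)
    (hYn : m.Null P atTop (fun n ω => max (weightedRatio w Y n ω - 1) 0))
    (hZn : m.Null P atTop (fun n ω => max (1 - weightedRatio w Z n ω) 0)) :
    m.Null P' atTop (fun n ω => weightedRatio w X' n ω - 1) := by
  refine (hX.null_comp_weightedRatio_iff hX' (φ := fun x => x - 1) (by fun_prop)).1 ?_
  have h1 := (hY.null_comp_weightedRatio_iff hX (φ := fun x => max (x - 1) 0) (by fun_prop)).1 hYn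
  have h2 := (hZ.null_comp_weightedRatio_iff hX (φ := fun x => max (1 - x) 0) (by fun_prop)).1 hZn
  have mX := hX.aemeasurable_weightedRatio w
  refine (h1.add h2 (fun n => ((mX n).sub_const 1).max aemeasurable_const)
    (fun n => ((mX n).const_sub 1).max aemeasurable_const)).mono univ_mem
    (ae_of_all _ fun ω n _ => ?_)
  refine le_trans ?_ (le_abs_self _)
  rw [abs_le]
  constructor
  · linarith [le_max_right (weightedRatio w X n ω - 1) 0,
      le_max_left (1 - weightedRatio w X n ω) 0]
  · linarith [le_max_left (weightedRatio w X n ω - 1) 0,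
      le_max_right (1 - weightedRatio w X n ω) 0]

end IsIIDStdExponential

/-- The increment of the process over `(k - 1, k]`. -/
def unitIncrement {Ω : Type*} (Γ : ℝ≥0 → Ω → ℝ) (k : ℕ) (ω : Ω) : ℝ :=
  Γ k ω - Γ ((k - 1 : ℕ) : ℝ≥0) ω

/-- The weighted sum `∑_{k=1}^n f(k) X_k`. -/
noncomputable def weightedSum {Ω : Type*} (f : ℝ → ℝ) (X : ℕ → Ω → ℝ) (n : ℕ) (ω : Ω) : ℝ :=
  ∑ k ∈ Finset.Icc 1 n, f k * X k ω

theorem weightedRatio_eq {Ω : Type*} (f : ℝ → ℝ) (X : ℕ → Ω → ℝ) (n : ℕ) (ω : Ω) :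
    weightedRatio (fun k => f k) X n ω = weightedSum f X n ω / weightSum f n := rfl

omit [MeasurableSpace Ω] in
theorem pathMeasure_real_unit {ω : Ω} (hω : IsIncreasingRightContinuous fun t => Γ t ω) (i : ℕ) :
    (pathMeasure fun t => Γ t ω).real (Ioc (i : ℝ) (i + 1)) = unitIncrement Γ (i + 1) ω := by
  rw [pathMeasure_real_Ioc hω (by linarith), unitIncrement]
  rw [← Nat.cast_add_one, Real.toNNReal_natCast, Real.toNNReal_natCast, Nat.add_sub_cancel]

-- A left-endpoint sum pairs `f i` with increment `i + 1`. Splitting off `i = 0` leaves a weighted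
-- sum for the shifted sequence.
omit [MeasurableSpace Ω] in
theorem sum_range_mul_unitIncrement (f : ℝ → ℝ) (Γ : ℝ≥0 → Ω → ℝ) (ω : Ω) (n : ℕ) :
    ∑ i ∈ Finset.range (n + 1), f i * unitIncrement Γ (i + 1) ω =
      f 0 * unitIncrement Γ 1 ω + weightedSum f (fun k => unitIncrement Γ (k + 1)) n ω := by
  rw [weightedSum, sum_Icc_one_eq_sum_range (fun k => f k * _), Finset.sum_range_succ']
  simp [add_comm]

omit [MeasurableSpace Ω] in
theorem MonotoneOn.gammaIntegral_le {ω : Ω} (hω : IsIncreasingRightContinuous fun t => Γ t ω)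
    (hf : MonotoneOn f (Ici 0)) (n : ℕ) :
    gammaIntegral Γ f n ω ≤ weightedSum f (unitIncrement Γ) n ω := by
  have := hf.setIntegral_Ioc_le_sum (μ := pathMeasure fun t => Γ t ω) zero_le_one n
  simp only [one_mul, pathMeasure_real_unit hω] at this
  rw [weightedSum, sum_Icc_one_eq_sum_range (fun k => f k * _), gammaIntegral]
  simpa using this

omit [MeasurableSpace Ω] in
theorem MonotoneOn.le_gammaIntegral {ω : Ω} (hω : IsIncreasingRightContinuous fun t => Γ t ω)
    (hf : MonotoneOn f (Ici 0)) (n : ℕ) :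
    f 0 * unitIncrement Γ 1 ω + weightedSum f (fun k => unitIncrement Γ (k + 1)) n ω ≤
      gammaIntegral Γ f (n + 1 : ℕ) ω := by
  have := hf.sum_le_setIntegral_Ioc (μ := pathMeasure fun t => Γ t ω) zero_le_one (n + 1)
  simp only [one_mul, pathMeasure_real_unit hω] at this
  rwa [sum_range_mul_unitIncrement] at this

omit [MeasurableSpace Ω] in
theorem AntitoneOn.le_gammaIntegral {ω : Ω} (hω : IsIncreasingRightContinuous fun t => Γ t ω)
    (hf : AntitoneOn f (Ici 0)) (n : ℕ) :
    weightedSum f (unitIncrement Γ) n ω ≤ gammaIntegral Γ f n ω := by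
  have := hf.sum_le_setIntegral_Ioc (μ := pathMeasure fun t => Γ t ω) zero_le_one n
  simp only [one_mul, pathMeasure_real_unit hω] at this
  rw [weightedSum, sum_Icc_one_eq_sum_range (fun k => f k * _), gammaIntegral]
  simpa using this

omit [MeasurableSpace Ω] in
theorem AntitoneOn.gammaIntegral_le {ω : Ω} (hω : IsIncreasingRightContinuous fun t => Γ t ω)
    (hf : AntitoneOn f (Ici 0)) (n : ℕ) :
    gammaIntegral Γ f (n + 1 : ℕ) ω ≤
      f 0 * unitIncrement Γ 1 ω + weightedSum f (fun k => unitIncrement Γ (k + 1)) n ω := by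
  have := hf.setIntegral_Ioc_le_sum (μ := pathMeasure fun t => Γ t ω) zero_le_one (n + 1)
  simp only [one_mul, pathMeasure_real_unit hω] at this
  rwa [sum_range_mul_unitIncrement] at this

omit [MeasurableSpace Ω] in
theorem unitIncrement_nonneg {ω : Ω} (hω : IsIncreasingRightContinuous fun t => Γ t ω) (k : ℕ) :
    0 ≤ unitIncrement Γ k ω :=
  sub_nonneg.2 (hω.1 (Nat.cast_le.2 (Nat.sub_le k 1)))

end Comparison

/-! ### Transfer of convergence for negligible weights -/

section Equivalence

variable {Ω Ω' : Type*} [MeasurableSpace Ω] [MeasurableSpace Ω'] {P : Measure Ω} {P' : Measure Ω'}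
  [IsProbabilityMeasure P] [IsProbabilityMeasure P']
  {Γ : ℝ≥0 → Ω → ℝ} {X : ℕ → Ω' → ℝ} {f : ℝ → ℝ} {m : ConvMode}

omit [IsProbabilityMeasure P] in
/-- A sandwich of the Gamma integral at integer times controls the ratio at all times. -/
theorem null_gammaRatio_of_sandwich
    (hf0 : ∀ x, 0 ≤ x → 0 ≤ f x) (hf : MonotoneOn f (Ici 0) ∨ AntitoneOn f (Ici 0))
    (hΛ : Tendsto (fun n : ℕ => ∫ x in Ioc 0 (n : ℝ), f x) atTop atTop) {L U : ℕ → Ω → ℝ}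
    (mL : ∀ n, AEMeasurable (L n) P) (mU : ∀ n, AEMeasurable (U n) P)
    (hLU : ∀ᵐ ω ∂P, ∀ n : ℕ, L n ω ≤ gammaIntegral Γ f (n + 1 : ℕ) ω ∧
      gammaIntegral Γ f (n + 2 : ℕ) ω ≤ U n ω)
    (hL : m.Null P atTop (fun n ω => L n ω / (∫ x in Ioc 0 ((n + 2 : ℕ) : ℝ), f x) - 1))
    (hU : m.Null P atTop (fun n ω => U n ω / (∫ x in Ioc 0 ((n + 1 : ℕ) : ℝ), f x) - 1)) :
    m.Null P atTop (fun t ω => gammaRatio Γ f t ω - 1) := by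
  have h1 := hL.abs.add hU.abs
    (fun n => continuous_abs.measurable.comp_aemeasurable (((mL n).div_const _).sub_const 1))
    (fun n => continuous_abs.measurable.comp_aemeasurable (((mU n).div_const _).sub_const 1))
  -- With `k = ⌊t⌋₊ - 1`, the time `t` lies in `[k + 1, k + 2)`.
  have hk : Tendsto (fun t : ℝ => ⌊t⌋₊ - 1) atTop atTop :=
    (tendsto_sub_atTop_nat 1).comp tendsto_nat_floor_atTop
  have hs : {t : ℝ | 1 ≤ t ∧ 0 < ∫ x in Ioc 0 ((⌊t⌋₊ - 1 + 1 : ℕ) : ℝ), f x} ∈ atTop :=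
    (eventually_ge_atTop 1).and
      (((hΛ.comp (tendsto_add_atTop_nat 1)).comp hk).eventually_gt_atTop 0)
  refine (h1.comp hk).mono hs ?_
  filter_upwards [hLU] with ω hω t ⟨ht1, ht2⟩
  have hfl : 1 ≤ ⌊t⌋₊ := Nat.le_floor (by simpa using ht1)
  set k := ⌊t⌋₊ - 1 with hkdef
  obtain ⟨hω1, hω2⟩ := hω k
  have hkt : ((k + 1 : ℕ) : ℝ) ≤ t := by
    rw [hkdef, Nat.sub_add_cancel hfl]
    exact Nat.floor_le (by linarith)
  have htk : t ≤ ((k + 2 : ℕ) : ℝ) := by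
    have : k + 2 = ⌊t⌋₊ + 1 := by omega
    rw [this]
    exact_mod_cast (Nat.lt_floor_add_one t).le
  have hΛ1 := setIntegral_mono_right (μ := volume) hf0 hf hkt
  have hΛ2 := setIntegral_mono_right (μ := volume) hf0 hf htk
  have hG1 := setIntegral_mono_right (μ := pathMeasure fun s => Γ s ω) hf0 hf hkt
  have hG2 := setIntegral_mono_right (μ := pathMeasure fun s => Γ s ω) hf0 hf htk
  rw [gammaRatio_eq_gammaIntegral_div Γ f (by linarith : (0 : ℝ) ≤ t)]
  have hG0 := gammaIntegral_nonneg (Γ := Γ) hf0 t ω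
  have hG0' := gammaIntegral_nonneg (Γ := Γ) hf0 (k + 1 : ℕ) ω
  set Λ1 := ∫ x in Ioc 0 ((k + 1 : ℕ) : ℝ), f x
  set Λ2 := ∫ x in Ioc 0 ((k + 2 : ℕ) : ℝ), f x
  set Λ := ∫ x in Ioc 0 t, f x
  have hge : L k ω / Λ2 ≤ gammaIntegral Γ f t ω / Λ :=
    calc L k ω / Λ2 ≤ gammaIntegral Γ f (k + 1 : ℕ) ω / Λ2 :=
          div_le_div_of_nonneg_right hω1 (by linarith)
      _ ≤ gammaIntegral Γ f t ω / Λ := div_le_div₀ hG0 hG1 (by linarith) hΛ2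
  have hle : gammaIntegral Γ f t ω / Λ ≤ U k ω / Λ1 :=
    div_le_div₀ (hG0.trans (hG2.trans hω2)) (hG2.trans hω2) ht2 hΛ1
  refine le_trans ?_ (le_abs_self _)
  rw [abs_le]
  constructor
  · linarith [neg_abs_le (L k ω / Λ2 - 1), abs_nonneg (U k ω / Λ1 - 1)]
  · linarith [le_abs_self (U k ω / Λ1 - 1), abs_nonneg (L k ω / Λ2 - 1)]

/-- Any normalization asymptotic to `weightSum f n` may replace it, for any exponential sequence. -/
theorem NegligibleWeights.null_weightedSum_div (hW : NegligibleWeights f) (hm : m.Admissible)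
    {Y : ℕ → Ω → ℝ} (hY : IsIIDStdExponential Y P) (hX : IsIIDStdExponential X P')
    (h : m.Null P' atTop (fun n ω => weightedRatio (fun k => f k) X n ω - 1)) {b : ℕ → ℝ}
    (hb : Tendsto (fun n => b n / weightSum f n) atTop (𝓝 1)) :
    m.Null P atTop (fun n ω => weightedSum f Y n ω / b n - 1) := by
  have h1 := (hX.null_comp_weightedRatio_iff hY (φ := fun x => x - 1) (by fun_prop)).1 h
  have hb' : Tendsto (fun n => weightSum f n / b n) atTop (𝓝 1) := by
    simpa using hb.inv₀ one_ne_zero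
  have h2 := h1.mul_sub_one hm (hY.aemeasurable_weightedRatio _) hb'
  refine h2.mono (hW.tendsto_weightSum.eventually_gt_atTop 0)
    (ae_of_all _ fun ω n hn => le_of_eq ?_)
  have hn' : weightSum f n ≠ 0 := ne_of_gt hn
  rw [weightedRatio_eq, mul_comm, div_mul_div_cancel₀ hn']

omit [IsProbabilityMeasure P] in
theorem aemeasurable_weightedSum {Y : ℕ → Ω → ℝ} (hY : IsIIDStdExponential Y P) (f : ℝ → ℝ)
    (n : ℕ) : AEMeasurable (weightedSum f Y n) P :=
  Finset.aemeasurable_fun_sum _ fun k hk =>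
    (hY.law k (Finset.mem_Icc.1 hk).1).aemeasurable.const_mul _

theorem NegligibleWeights.tendsto_setIntegral_add_two_div (hW : NegligibleWeights f)
    (hf0 : ∀ x, 0 ≤ x → 0 ≤ f x) (hf : MonotoneOn f (Ici 0) ∨ AntitoneOn f (Ici 0)) :
    Tendsto (fun n : ℕ => (∫ x in Ioc 0 ((n + 2 : ℕ) : ℝ), f x) / weightSum f n) atTop (𝓝 1) := by
  have h1 := ((hW.tendsto_setIntegral_succ_div hf0 hf).comp (tendsto_add_atTop_nat 1)).div
    hW.tendsto_weightSum_div_succ one_ne_zero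
  rw [div_one] at h1
  refine h1.congr' ?_
  filter_upwards [hW.tendsto_weightSum.eventually_gt_atTop 0,
    (hW.tendsto_weightSum.comp (tendsto_add_atTop_nat 1)).eventually_gt_atTop 0] with n h2 h3
  simp only [Function.comp_apply, Pi.div_apply] at h3 ⊢
  field_simp

theorem NegligibleWeights.null_gammaRatio (hW : NegligibleWeights f) (hm : m.Admissible)
    (hΓ : IsGammaProcess Γ P) (hX : IsIIDStdExponential X P')
    (hf0 : ∀ x, 0 ≤ x → 0 ≤ f x) (hf : MonotoneOn f (Ici 0) ∨ AntitoneOn f (Ici 0))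
    (h : m.Null P' atTop (fun n ω => weightedRatio (fun k => f k) X n ω - 1)) :
    m.Null P atTop (fun t ω => gammaRatio Γ f t ω - 1) := by
  have hξ : IsIIDStdExponential (unitIncrement Γ) P := hΓ.isIIDStdExponential
  have hξ' := hξ.shift
  have hΛ0 := hW.tendsto_setIntegral_div hf0 hf
  have hΛ1 := hW.tendsto_setIntegral_succ_div hf0 hf
  have hΛ2 := hW.tendsto_setIntegral_add_two_div hf0 hf
  have hΛ := hW.tendsto_setIntegral hf0 hf
  rcases hf with hf | hf
  · refine null_gammaRatio_of_sandwich hf0 (.inl hf) hΛ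
      (L := weightedSum f fun k => unitIncrement Γ (k + 1))
      (U := fun n => weightedSum f (unitIncrement Γ) (n + 2)) (aemeasurable_weightedSum hξ' f)
      (fun n => aemeasurable_weightedSum hξ f _) ?_
      (hW.null_weightedSum_div hm hξ' hX h hΛ2) ?_
    · filter_upwards [hΓ.path] with ω hω n
      refine ⟨?_, hf.gammaIntegral_le hω (n + 2)⟩
      have := mul_nonneg (hf0 0 le_rfl) (unitIncrement_nonneg hω 1)
      linarith [hf.le_gammaIntegral hω n]
    -- The upper sum runs to `n + 2` but is divided by the integral up to `n + 1`, hence the lag of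
    -- one in `b`.
    · have h1 := (hW.null_weightedSum_div hm hξ hX h
        (b := fun n => ∫ x in Ioc 0 ((n - 1 : ℕ) : ℝ), f x) ?_).comp (tendsto_add_atTop_nat 2)
      · exact h1
      · rw [← tendsto_add_atTop_iff_nat 1]
        refine (hΛ0.mul hW.tendsto_weightSum_div_succ).congr' ?_ |>.trans (by rw [one_mul])
        filter_upwards [hW.tendsto_weightSum.eventually_gt_atTop 0] with n hn
        rw [div_mul_div_cancel₀ hn.ne', Nat.add_sub_cancel]
  · refine null_gammaRatio_of_sandwich hf0 (.inr hf) hΛ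
      (L := fun n => weightedSum f (unitIncrement Γ) (n + 1))
      (U := fun n ω => f 0 * unitIncrement Γ 1 ω +
        weightedSum f (fun k => unitIncrement Γ (k + 1)) (n + 1) ω)
      (fun n => aemeasurable_weightedSum hξ f _)
      (fun n => ((hξ.aemeasurable 0).const_mul _).add (aemeasurable_weightedSum hξ' f _)) ?_ ?_ ?_
    · filter_upwards [hΓ.path] with ω hω n
      exact ⟨hf.le_gammaIntegral hω (n + 1), hf.gammaIntegral_le hω (n + 1)⟩
    · exact (hW.null_weightedSum_div hm hξ hX h hΛ1).comp (tendsto_add_atTop_nat 1)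
    · have h1 := hW.null_weightedSum_div hm hξ' hX h hΛ0
      -- The extra term `f 0 * ξ_1` over a diverging denominator is null in every mode, as `ξ_1` has
      -- all moments.
      have h2 := ConvMode.null_tendsto_mul hm (hΛ.const_div_atTop (f 0)) (hξ.aemeasurable 0)
        (fun p hp => hξ.memLp 0 hp)
      have h3 := (h1.add h2 (fun n => ((aemeasurable_weightedSum hξ' f n).div_const _).sub_const 1)
        (fun n => (hξ.aemeasurable 0).const_mul _)).comp (tendsto_add_atTop_nat 1)
      refine h3.mono univ_mem (ae_of_all _ fun ω n _ => le_of_eq ?_)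
      congr 1
      ring

theorem NegligibleWeights.null_weightedRatio (hW : NegligibleWeights f) (hm : m.Admissible)
    (hΓ : IsGammaProcess Γ P) (hX : IsIIDStdExponential X P')
    (hf0 : ∀ x, 0 ≤ x → 0 ≤ f x) (hf : MonotoneOn f (Ici 0) ∨ AntitoneOn f (Ici 0))
    (h : m.Null P atTop (fun t ω => gammaRatio Γ f t ω - 1)) :
    m.Null P' atTop (fun n ω => weightedRatio (fun k => f k) X n ω - 1) := by
  have hξ : IsIIDStdExponential (unitIncrement Γ) P := hΓ.isIIDStdExponential
  have hξ' := hξ.shift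
  have hΛ := hW.tendsto_setIntegral hf0 hf
  have mR := aemeasurable_gammaRatio hΓ hf0 hf
  have mR1 : ∀ n : ℕ, AEMeasurable (gammaRatio Γ f n) P := fun n => mR n
  have mR2 : ∀ n : ℕ, AEMeasurable (gammaRatio Γ f (n + 1 : ℕ)) P := fun n => mR (n + 1 : ℕ)
  have h1 := (h.comp tendsto_natCast_atTop_atTop).mul_sub_one hm mR1
    (hW.tendsto_setIntegral_div hf0 hf)
  -- The left-endpoint sum up to time `n + 1` involves only `f 0, …, f n`, so the integral there is
  -- compared with `weightSum f n`.
  have h2 := ((h.comp tendsto_natCast_atTop_atTop).comp (tendsto_add_atTop_nat 1)).mul_sub_one hm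
    mR2 (hW.tendsto_setIntegral_succ_div hf0 hf)
  have hs : {n | 0 < weightSum f n ∧ (0 < ∫ x in Ioc 0 (n : ℝ), f x) ∧
      0 < ∫ x in Ioc 0 ((n + 1 : ℕ) : ℝ), f x} ∈ atTop :=
    (hW.tendsto_weightSum.eventually_gt_atTop 0).and ((hΛ.eventually_gt_atTop 0).and
      ((hΛ.comp (tendsto_add_atTop_nat 1)).eventually_gt_atTop 0))
  have e1 : ∀ (n : ℕ) ω, (0 < ∫ x in Ioc 0 (n : ℝ), f x) →
      (∫ x in Ioc 0 (n : ℝ), f x) / weightSum f n * gammaRatio Γ f n ω =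
        gammaIntegral Γ f n ω / weightSum f n := fun n ω hn => by
    rw [gammaRatio_eq_gammaIntegral_div Γ f (by positivity), mul_comm, div_mul_div_cancel₀ hn.ne']
  have e2 : ∀ (n : ℕ) ω, (0 < ∫ x in Ioc 0 ((n + 1 : ℕ) : ℝ), f x) →
      (∫ x in Ioc 0 ((n + 1 : ℕ) : ℝ), f x) / weightSum f n * gammaRatio Γ f (n + 1 : ℕ) ω =
        gammaIntegral Γ f (n + 1 : ℕ) ω / weightSum f n := fun n ω hn => by
    rw [gammaRatio_eq_gammaIntegral_div Γ f (by positivity), mul_comm, div_mul_div_cancel₀ hn.ne']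
  rcases hf with hf | hf
  · refine hξ.null_weightedRatio_sub_one_of_posPart hX hξ' hξ (h2.mono hs ?_) (h1.mono hs ?_)
    · filter_upwards [hΓ.path] with ω hω n ⟨hn1, hn2, hn3⟩
      rw [e2 n ω hn3, abs_of_nonneg (le_max_right _ _), weightedRatio_eq]
      refine max_le (le_trans ?_ (le_abs_self _)) (abs_nonneg _)
      have := mul_nonneg (hf0 0 le_rfl) (unitIncrement_nonneg hω 1)
      gcongr
      linarith [hf.le_gammaIntegral hω n]
    · filter_upwards [hΓ.path] with ω hω n ⟨hn1, hn2, hn3⟩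
      rw [e1 n ω hn2, abs_of_nonneg (le_max_right _ _), weightedRatio_eq]
      refine max_le (le_trans ?_ (neg_le_abs _)) (abs_nonneg _)
      rw [neg_sub]
      gcongr
      exact hf.gammaIntegral_le hω n
  · have h3 := ConvMode.null_tendsto_mul hm (hW.tendsto_weightSum.const_div_atTop (f 0))
      (hξ.aemeasurable 0) (fun p hp => hξ.memLp 0 hp)
    have h4 := h2.abs.add h3.abs
      (fun n => continuous_abs.measurable.comp_aemeasurable (((mR2 n).const_mul _).sub_const 1))
      (fun n => continuous_abs.measurable.comp_aemeasurable ((hξ.aemeasurable 0).const_mul _))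
    -- For antitone `f` the two sequences exchange roles, and `f 0 * ξ_1` can no longer be dropped
    -- by its sign.
    refine hξ.null_weightedRatio_sub_one_of_posPart hX hξ hξ' (h1.mono hs ?_) (h4.mono hs ?_)
    · filter_upwards [hΓ.path] with ω hω n ⟨hn1, hn2, hn3⟩
      rw [e1 n ω hn2, abs_of_nonneg (le_max_right _ _), weightedRatio_eq]
      refine max_le (le_trans ?_ (le_abs_self _)) (abs_nonneg _)
      gcongr
      exact hf.le_gammaIntegral hω n
    · filter_upwards [hΓ.path] with ω hω n ⟨hn1, hn2, hn3⟩
      rw [e2 n ω hn3, abs_of_nonneg (le_max_right _ _), weightedRatio_eq]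
      refine max_le ?_ (abs_nonneg _)
      refine le_trans ?_ (le_abs_self _)
      have h5 := neg_le_abs (gammaIntegral Γ f (n + 1 : ℕ) ω / weightSum f n - 1)
      have h6 := le_abs_self (f 0 / weightSum f n * unitIncrement Γ (0 + 1) ω)
      have h7 : gammaIntegral Γ f (n + 1 : ℕ) ω / weightSum f n ≤
          f 0 / weightSum f n * unitIncrement Γ (0 + 1) ω +
          weightedSum f (fun k => unitIncrement Γ (k + 1)) n ω / weightSum f n := by
        rw [div_mul_eq_mul_div, ← add_div]
        gcongr
        exact hf.gammaIntegral_le hω n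
      linarith

end Equivalence

/-! ### Non-negligible weights: failure of both convergences -/

section NonNegligible

variable {Ω Ω' : Type*} [MeasurableSpace Ω] [MeasurableSpace Ω'] {P : Measure Ω} {P' : Measure Ω'}
  [IsProbabilityMeasure P] [IsProbabilityMeasure P']
  {Γ : ℝ≥0 → Ω → ℝ} {X : ℕ → Ω' → ℝ} {f : ℝ → ℝ}

omit [IsProbabilityMeasure P'] in
theorem not_null_gammaRatio_of_eq_zero (hf : ∀ x, 0 < x → f x = 0) :
    ¬ ConvMode.inMeasure.Null P atTop (fun t ω => gammaRatio Γ f t ω - 1) := by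
  refine not_null_of_frequently_eq_neg_one
    ((eventually_ge_atTop 0).mono fun t ht ω => ?_).frequently
  have : ∫ x in Ioc 0 t, f x = 0 := by
    rw [setIntegral_congr_fun measurableSet_Ioc fun x hx => hf x hx.1]
    simp
  rw [gammaRatio_eq_gammaIntegral_div Γ f ht, this]
  simp

theorem not_null_weightedRatio_of_eq_zero (hf : ∀ x, 1 ≤ x → f x = 0) :
    ¬ ConvMode.inMeasure.Null P' atTop (fun n ω => weightedRatio (fun k => f k) X n ω - 1) := by
  refine not_null_of_frequently_eq_neg_one (Frequently.of_forall fun n ω => ?_)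
  have : ∑ k ∈ Finset.Icc 1 n, f k = 0 := Finset.sum_eq_zero fun k hk =>
    hf k (by exact_mod_cast (Finset.mem_Icc.1 hk).1)
  simp [weightedRatio, this]

theorem weightSum_nonneg (hf0 : ∀ x, 0 ≤ x → 0 ≤ f x) (n : ℕ) : 0 ≤ weightSum f n :=
  Finset.sum_nonneg fun k _ => hf0 k k.cast_nonneg

theorem weightSum_mono (hf0 : ∀ x, 0 ≤ x → 0 ≤ f x) : Monotone (weightSum f) :=
  monotone_nat_of_le_succ fun n => by
    rw [weightSum_succ]
    linarith [hf0 (n + 1 : ℕ) (by positivity)]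

theorem mul_sub_le_setIntegral (hf0 : ∀ x, 0 ≤ x → 0 ≤ f x) (hf : MonotoneOn f (Ici 0)) {s t : ℝ}
    (hs : 0 ≤ s) (hst : s ≤ t) : f s * (t - s) ≤ ∫ x in Ioc 0 t, f x := by
  rw [setIntegral_Ioc_add (.inl hf) le_rfl hs hst]
  have h1 := le_setIntegral_Ioc (μ := volume) (.inl hf) (b := t) hs
    fun x hx => hf hs (hs.trans hx.1.le) hx.1.le
  rw [Real.volume_real_Ioc_of_le hst] at h1
  have h2 : 0 ≤ ∫ x in Ioc 0 s, f x :=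
    setIntegral_nonneg measurableSet_Ioc fun x hx => hf0 x hx.1.le
  linarith

theorem tendsto_setIntegral_atTop_of_monotoneOn (hf0 : ∀ x, 0 ≤ x → 0 ≤ f x)
    (hf : MonotoneOn f (Ici 0)) {s : ℝ} (hs : 0 ≤ s) (hfs : 0 < f s) :
    Tendsto (fun t => ∫ x in Ioc 0 t, f x) atTop atTop := by
  refine tendsto_atTop_mono' atTop ?_
    ((tendsto_atTop_add_const_right atTop (-s) tendsto_id).const_mul_atTop hfs)
  filter_upwards [eventually_ge_atTop s] with t ht using mul_sub_le_setIntegral hf0 hf hs ht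

/-- The primitive is continuous and unbounded. Exact doubling makes `(s, t]` carry half of the mass
on `(0, t]`. -/
theorem exists_setIntegral_eq_two_mul (hf0 : ∀ x, 0 ≤ x → 0 ≤ f x)
    (hf : MonotoneOn f (Ici 0)) (hΛ : Tendsto (fun t => ∫ x in Ioc 0 t, f x) atTop atTop) {s : ℝ}
    (hs : 0 ≤ s) : ∃ t, s ≤ t ∧ ∫ x in Ioc 0 t, f x = 2 * ∫ x in Ioc 0 s, f x := by
  obtain ⟨u, hu1, hu2⟩ := ((hΛ.eventually_ge_atTop (2 * ∫ x in Ioc 0 s, f x)).and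
    (eventually_ge_atTop s)).exists
  have hmono : Monotone fun x => f (max x 0) := fun x y hxy =>
    hf (le_max_right x 0) (le_max_right y 0) (max_le_max_right 0 hxy)
  have hcont : Continuous fun t => ∫ x in (0 : ℝ)..t, f (max x 0) :=
    intervalIntegral.continuous_primitive (fun a b => hmono.intervalIntegrable) 0
  have heq : ∀ t, 0 ≤ t → ∫ x in (0 : ℝ)..t, f (max x 0) = ∫ x in Ioc 0 t, f x := fun t ht => by
    rw [intervalIntegral.integral_of_le ht]
    exact setIntegral_congr_fun measurableSet_Ioc fun x hx => by simp [max_eq_left hx.1.le]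
  have h0 : 0 ≤ ∫ x in Ioc 0 s, f x :=
    setIntegral_nonneg measurableSet_Ioc fun x hx => hf0 x hx.1.le
  obtain ⟨t, ht, htL⟩ := intermediate_value_Icc hu2 hcont.continuousOn
    (show (2 * ∫ x in Ioc 0 s, f x) ∈ Icc _ _ from
      ⟨by rw [heq s hs]; linarith, by rw [heq u (hs.trans hu2)]; exact hu1⟩)
  refine ⟨t, ht.1, ?_⟩
  rw [← heq t (hs.trans ht.1)]
  exact htL

-- From a time `n` with a heavy weight, continue until the mass has doubled. On `(n, t]` one has `f
-- ≥ f n ≥ δ * weightSum f n`, which is at least `δ / 2` times the mass on `(0, t]`.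
omit [IsProbabilityMeasure P'] in
theorem MonotoneOn.not_null_gammaRatio (hΓ : IsGammaProcess Γ P) (hf0 : ∀ x, 0 ≤ x → 0 ≤ f x)
    (hf : MonotoneOn f (Ici 0)) {s₀ : ℝ} (hs₀ : 0 ≤ s₀) (hfs₀ : 0 < f s₀) {δ : ℝ} (hδ : 0 < δ)
    (h : ∃ᶠ n : ℕ in atTop, δ * weightSum f n ≤ f n) :
    ¬ ConvMode.inMeasure.Null P atTop (fun t ω => gammaRatio Γ f t ω - 1) := by
  have hΛ := tendsto_setIntegral_atTop_of_monotoneOn hf0 hf hs₀ hfs₀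
  refine hΓ.not_null_of_frequently hf0 (.inl hf) (c := δ / 2) (η := 1 / 2) (by positivity)
    (by norm_num) (frequently_atTop.2 fun T => ?_)
  obtain ⟨n, hn1, hn2, hn3⟩ := (h.and_eventually
    ((tendsto_natCast_atTop_atTop.eventually_ge_atTop T).and
      ((hΛ.comp tendsto_natCast_atTop_atTop).eventually_gt_atTop 0))).exists
  simp only [Function.comp_apply] at hn3
  have hn0 : (0 : ℝ) ≤ n := n.cast_nonneg
  obtain ⟨t, hnt, ht⟩ := exists_setIntegral_eq_two_mul hf0 hf hΛ hn0
  refine ⟨t, hn2.trans hnt, by linarith, n, t, hn0, hnt, le_rfl, fun x hx => ?_, ?_⟩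
  · have h1 := hf hn0 (hn0.trans hx.1.le) hx.1.le
    have h2 := mul_le_mul_of_nonneg_left (hf.setIntegral_le_weightSum n) hδ.le
    rw [ht]
    linarith
  · have h1 := setIntegral_Ioc_add (μ := volume) (.inl hf) le_rfl hn0 hnt
    linarith

-- The total mass is at most `f 0 + C`, so a fixed interval `(0, a]` with `f a > 0` always carries a
-- fixed proportion of it.
omit [IsProbabilityMeasure P'] in
theorem AntitoneOn.not_null_gammaRatio (hΓ : IsGammaProcess Γ P) (hf0 : ∀ x, 0 ≤ x → 0 ≤ f x)
    (hf : AntitoneOn f (Ici 0)) {C : ℝ} (hC : ∀ n, weightSum f n ≤ C) :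
    ¬ ConvMode.inMeasure.Null P atTop (fun t ω => gammaRatio Γ f t ω - 1) := by
  by_cases h : ∀ x, 0 < x → f x = 0
  · exact not_null_gammaRatio_of_eq_zero h
  push Not at h
  obtain ⟨a, ha, hfa⟩ := h
  have hfa' : 0 < f a := lt_of_le_of_ne (hf0 a ha.le) hfa.symm
  have hK : ∀ t, ∫ x in Ioc 0 t, f x ≤ f 0 + C := fun t => by
    refine (setIntegral_mono_right hf0 (.inr hf) (Nat.le_ceil t)).trans ?_
    have h1 := hf.setIntegral_le_sum_range ⌈t⌉₊
    have h2 := sum_range_add_last f ⌈t⌉₊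
    linarith [hC ⌈t⌉₊, hf0 ⌈t⌉₊ (Nat.cast_nonneg _)]
  have haf : f a * a ≤ ∫ x in Ioc 0 a, f x := by
    have := le_setIntegral_Ioc (μ := volume) (.inr hf) (a := 0) (b := a) le_rfl
      fun x hx => hf hx.1.le ha.le hx.2
    simpa [Real.volume_real_Ioc_of_le ha.le] using this
  have hK0 : 0 < f 0 + C := by
    have := hK a
    have : 0 < f a * a := by positivity
    linarith
  refine hΓ.not_null_of_frequently hf0 (.inr hf) (c := f a / (f 0 + C))
    (η := f a * a / (f 0 + C)) (by positivity) (by positivity)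
    ((eventually_ge_atTop a).mono fun t ht => ?_).frequently
  have hmul : ∀ y, 0 ≤ y → (y / (f 0 + C) * ∫ x in Ioc 0 t, f x) ≤ y := fun y hy => by
    rw [div_mul_eq_mul_div, div_le_iff₀ hK0]
    exact mul_le_mul_of_nonneg_left (hK t) hy
  refine ⟨?_, 0, a, le_rfl, ha.le, ht, fun x hx => ?_, (hmul _ (by positivity)).trans haf⟩
  · have := setIntegral_mono_right (μ := volume) hf0 (.inr hf) ht
    have : 0 < f a * a := by positivity
    linarith
  · exact (hmul _ hfa'.le).trans (hf hx.1.le ha.le hx.2)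

/-- The first weight keeps the proportion `f 1 / C`; if `f 1 = 0`, all weights vanish. -/
theorem AntitoneOn.not_null_weightedRatio (hX : IsIIDStdExponential X P')
    (hf0 : ∀ x, 0 ≤ x → 0 ≤ f x) (hf : AntitoneOn f (Ici 0)) {C : ℝ}
    (hC : ∀ n, weightSum f n ≤ C) :
    ¬ ConvMode.inMeasure.Null P' atTop (fun n ω => weightedRatio (fun k => f k) X n ω - 1) := by
  rcases (hf0 1 zero_le_one).eq_or_lt with h1 | h1
  · refine not_null_weightedRatio_of_eq_zero fun x hx => le_antisymm ?_ (hf0 x (by linarith))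
    rw [h1]
    exact hf (zero_le_one (α := ℝ)) (show 0 ≤ x by linarith) hx
  have hW1 : weightSum f 1 = f 1 := by simp [weightSum]
  have hC0 : 0 < C := by linarith [hC 1]
  refine hX.not_null_of_frequently (fun k => hf0 k k.cast_nonneg) (c := f 1 / C) (by positivity)
    ((eventually_ge_atTop 1).mono fun n hn => ⟨?_, 1, by simp [hn], ?_⟩).frequently
  · have := weightSum_mono hf0 hn
    rw [hW1] at this
    exact h1.trans_le this
  · rw [div_mul_eq_mul_div, div_le_iff₀ hC0, Nat.cast_one]
    exact mul_le_mul_of_nonneg_left (hC n) h1.le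

/-- For monotone nonzero `f` the weights always sum to infinity, and only `f n / weightSum f n → 0`
can fail. For antitone `f` that limit follows from `f n ≤ f 0` once the sums diverge, and only
divergence can fail. -/
theorem negligibleWeights_or_not_null (hΓ : IsGammaProcess Γ P) (hX : IsIIDStdExponential X P')
    (hf0 : ∀ x, 0 ≤ x → 0 ≤ f x) (hf : MonotoneOn f (Ici 0) ∨ AntitoneOn f (Ici 0)) :
    NegligibleWeights f ∨
      (¬ ConvMode.inMeasure.Null P atTop (fun t ω => gammaRatio Γ f t ω - 1) ∧
        ¬ ConvMode.inMeasure.Null P' atTop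
          (fun n ω => weightedRatio (fun k => f k) X n ω - 1)) := by
  rcases hf with hf | hf
  · by_cases hz : ∀ x, 0 ≤ x → f x = 0
    · exact .inr ⟨not_null_gammaRatio_of_eq_zero fun x hx => hz x hx.le,
        not_null_weightedRatio_of_eq_zero fun x hx => hz x (by linarith)⟩
    push Not at hz
    obtain ⟨s, hs, hfs⟩ := hz
    have hfs' : 0 < f s := lt_of_le_of_ne (hf0 s hs) hfs.symm
    have hW : Tendsto (weightSum f) atTop atTop :=
      tendsto_atTop_mono hf.setIntegral_le_weightSum
        ((tendsto_setIntegral_atTop_of_monotoneOn hf0 hf hs hfs').comp tendsto_natCast_atTop_atTop)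
    by_cases h : Tendsto (fun n : ℕ => f n / weightSum f n) atTop (𝓝 0)
    · exact .inl ⟨hW, h⟩
    obtain ⟨δ, hδ, hfr⟩ : ∃ δ > 0, ∃ᶠ n : ℕ in atTop, δ * weightSum f n ≤ f n := by
      by_contra hc
      push Not at hc
      refine h (squeeze_zero_norm' (a := fun n : ℕ => |f n / weightSum f n|)
        (Eventually.of_forall fun n => le_rfl) ?_)
      rw [Metric.tendsto_nhds]
      intro δ hδ
      filter_upwards [hc δ hδ, hW.eventually_gt_atTop 0] with n hn hn0
      have : 0 ≤ f n / weightSum f n := div_nonneg (hf0 n n.cast_nonneg) hn0.le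
      rw [Real.dist_eq, sub_zero, abs_abs, abs_of_nonneg this, div_lt_iff₀ hn0]
      exact hn
    refine .inr ⟨hf.not_null_gammaRatio hΓ hf0 hs hfs' hδ hfr,
      hX.not_null_of_frequently (fun k => hf0 k k.cast_nonneg) hδ ?_⟩
    refine (hfr.and_eventually ((hW.eventually_gt_atTop 0).and (eventually_ge_atTop 1))).mono
      fun n ⟨h1, h2, h3⟩ => ⟨h2, n, by simp [h3], h1⟩
  · by_cases hC : ∃ C, ∀ n, weightSum f n ≤ C
    · obtain ⟨C, hC⟩ := hC
      exact .inr ⟨hf.not_null_gammaRatio hΓ hf0 hC, hf.not_null_weightedRatio hX hf0 hC⟩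
    · push Not at hC
      have hW : Tendsto (weightSum f) atTop atTop :=
        tendsto_atTop_atTop_of_monotone (weightSum_mono hf0) fun b => (hC b).imp fun _ h => h.le
      refine .inl ⟨hW, squeeze_zero (fun n => div_nonneg (hf0 n n.cast_nonneg)
        (weightSum_nonneg hf0 n)) (fun n => ?_) (hW.const_div_atTop (f 0))⟩
      have h1 := weightSum_nonneg hf0 n
      gcongr
      exact hf (show (0 : ℝ) ≤ 0 from le_rfl) (show (0 : ℝ) ≤ n from n.cast_nonneg) n.cast_nonneg

/-- In each mode of convergence, the ratio for the Gamma process converges to `1` if and only if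
the ratio for the weighted sums of exponential variables does. -/
theorem null_gammaRatio_iff_null_weightedRatio {m : ConvMode} (hm : m.Admissible)
    (hΓ : IsGammaProcess Γ P) (hX : IsIIDStdExponential X P')
    (hf0 : ∀ x, 0 ≤ x → 0 ≤ f x) (hf : MonotoneOn f (Ici 0) ∨ AntitoneOn f (Ici 0)) :
    m.Null P atTop (fun t ω => gammaRatio Γ f t ω - 1) ↔
      m.Null P' atTop (fun n ω => weightedRatio (fun k => f k) X n ω - 1) := by
  rcases negligibleWeights_or_not_null hΓ hX hf0 hf with hW | ⟨h1, h2⟩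
  · exact ⟨hW.null_weightedRatio hm hΓ hX hf0 hf, hW.null_gammaRatio hm hΓ hX hf0 hf⟩
  · refine iff_of_false (fun h => h1 ?_) (fun h => h2 ?_)
    · exact h.tendstoInMeasure hm fun t => (aemeasurable_gammaRatio hΓ hf0 hf t).sub_const 1
    · exact h.tendstoInMeasure hm fun n => (hX.aemeasurable_weightedRatio _ n).sub_const 1

end NonNegligible

theorem mainTheorem1 {Ω Ω' : Type*} [MeasurableSpace Ω] [MeasurableSpace Ω']
    (P : Measure Ω) [IsProbabilityMeasure P] (P' : Measure Ω') [IsProbabilityMeasure P']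
    (Γ : ℝ≥0 → Ω → ℝ) (hΓ : IsGammaProcess Γ P)
    (X : ℕ → Ω' → ℝ) (hX : IsIIDStdExponential X P')
    (f : ℝ → ℝ) (hf0 : ∀ x, 0 ≤ x → 0 ≤ f x)
    (hf : MonotoneOn f (Ici 0) ∨ AntitoneOn f (Ici 0)) :
    -- convergence in probability
    (TendstoInMeasure P (gammaRatio Γ f) atTop (fun _ => 1) ↔
      TendstoInMeasure P' (weightedRatio (fun k => f k) X) atTop (fun _ => 1)) ∧
    -- convergence in `L^p`, `0 < p < ∞`
    (∀ p : ℝ≥0∞, p ≠ 0 → p ≠ ∞ →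
      (Tendsto (fun t : ℝ => eLpNorm (fun ω => gammaRatio Γ f t ω - 1) p P) atTop (𝓝 0) ↔
        Tendsto (fun n : ℕ => eLpNorm (fun ω => weightedRatio (fun k => f k) X n ω - 1) p P')
          atTop (𝓝 0))) ∧
    -- almost sure convergence
    ((∀ᵐ ω ∂P, Tendsto (fun t : ℝ => gammaRatio Γ f t ω) atTop (𝓝 1)) ↔
      (∀ᵐ ω ∂P', Tendsto (fun n : ℕ => weightedRatio (fun k => f k) X n ω) atTop (𝓝 1))) := by
  refine ⟨?_, fun p hp0 hp => ?_, ?_⟩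
  · have h := null_gammaRatio_iff_null_weightedRatio (m := .inMeasure) trivial hΓ hX hf0 hf
    rw [ConvMode.null_inMeasure_iff, ConvMode.null_inMeasure_iff] at h
    rw [tendstoInMeasure_iff_norm, tendstoInMeasure_iff_norm]
    exact h
  · exact null_gammaRatio_iff_null_weightedRatio (m := .inLp p) ⟨hp0, hp⟩ hΓ hX hf0 hf
  · have h := null_gammaRatio_iff_null_weightedRatio (m := .ae) trivial hΓ hX hf0 hf
    simpa only [ConvMode.Null, tendsto_sub_nhds_zero_iff] using h
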